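/- Let $\mathbb X\in\mathcal B(\mathbb R^m)$, $\mathbb Y\in\mathcal B(\mathbb R^n)$, $N_0\in\mathbb N$, let $R$ be a stochastic kernel on $\mathbb X\times\mathbb Y$, $\mathbf H:\mathbb X\times\mathbb Y\to\mathbb R$, and $(\mathbf x,\mathbf y)\in\mathbb X\times\mathbb Y$. Let $\lambda$, $\nu$ be probability measures on $\mathbb X$, $\mathbb Y$ and $r:(\mathbb X\times\mathbb Y)^2\to[0,\infty)$ a measurable function such that: - (A1) $R(B\times C\,|\,x,y)=\int_{B\times C} r(u,v,x,y)\,\lambda(du)\nu(dv)$ for all $(x,y)\in\mathbb X\times\mathbb Y$, $B\in\mathcal B(\mathbb X)$, $C\in\mathcal B(\mathbb Y)$; - (B) there are constants $\bar r,L_r>0$ with $r\le\bar r$ and $|r(u,v,x,y)-r(u',v,x',y')|\le L_r\big[|u-u'|+|x-x'|+|y-y'|\big]$ for all $u,u',x,x'\in\mathbb X$, $v,y,y'\in\mathbb Y$; - (D) $\mathbf H$ is bounded and Lipschitz. For $\theta\in\mathcal P(\mathbb X)$ (the probability measures on $\mathbb X$) write $\mathbf H(\theta,y)=\int\mathbf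 H(x,y)\theta(dx)$, $r(u,v,\theta,y)=\int r(u,v,x,y)\theta(dx)$, $r(\lambda,v,\theta,y)=\int r(u,v,\theta,y)\lambda(du)$, $R(\cdot\,|\,\theta,y)=\int R(\cdot\,|\,x,y)\theta(dx)$. *Partially observed problem.* A weak control $\ell$ consists of a filtered probability space $(\Xi,\mathcal G,\mathbf Q,\{\mathcal G_t\}_{0\le t\le N_0})$, an $\mathbb X\times\mathbb Y$-valued $\{\mathcal G_t\}$-Markov chain $\{(\mathcal X_t,\mathcal Y_t)\}_{0\le t\le N_0}$ on it with transition kernel $R$ and initial law $\delta_{(\mathbf x,\mathbf y)}$, and a $\{0,\dots,N_0\}$-valued stopping time $\tau$ of the filtration $\sigma\{\mathcal Y_0,\dots,\mathcal Y_t\}$. Set $\overline{\mathcal H}(\mathbf x,\mathbf y)=\sup_\ell E^{\mathbf Q}[\mathbf H(\mathcal X_\tau,\mathcal Y_\tau)]$. *Fully observed problem.* Let $\Phi(v,\theta,y)(du)=\frac{r(u,v,\theta,y)}{r(\lambda,v,\theta,y)}\lambda(du)$ (and $\Phi(v,\theta,y)=\lambda$, by convention, where the denominator vanishes), and $$S(B\times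 C\,|\,\theta,y)=\int_C\delta_{\Phi(v,\theta,y)}(B)\,R(\mathbb X,dv\,|\,\theta,y).$$ Let $\mathcal M$ be the control model with states $(\theta,y,z)\in\mathcal P(\mathbb X)\times\mathbb Y\times\{0,1\}$, actions $a\in\{0,1\}$, transition kernel $Q(B\times C\times D\,|\,\theta,y,z,a)=S(B\times C\,|\,\theta,y)\,[\delta_z(D)1_{\{a=0\}}+\delta_1(D)1_{\{a=1\}}]$, stage reward $\mathbf H(\theta,y)1_{\{(z,a)=(0,1)\}}$ and terminal reward $\mathbf H(\theta,y)1_{\{z=0\}}$. A policy $\pi=(\pi_t)_{0\le t\le N_0-1}$ consists of measurable $\{0,1\}$-valued functions, giving the actions $A_t=\pi_t(Y_0,Z_0,A_0,\dots,Y_{t-1},Z_{t-1},A_{t-1},Y_t,Z_t)$ on the trajectory space $(\mathcal P(\mathbb X)\times\mathbb Y\times\{0,1\})^{N_0+1}$ with coordinates $(\Theta_t,Y_t,Z_t)$. For each policy $\pi$ there is exactly one probability measure $P^\pi$ on the trajectory space for which $(\Theta_0,Y_0,Z_0)=(\delta_{\mathbf x},\mathbf y,0)$ almost surely and, for $t<N_0$,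 the conditional law of $(\Theta_{t+1},Y_{t+1},Z_{t+1})$ given the coordinates up to time $t$ is $Q(\cdot\,|\,\Theta_t,Y_t,Z_t,A_t)$. Set $$\overline{\mathcal H}_{\mathcal M}(\mathbf x,\mathbf y)=\sup_\pi\Big(E^\pi\Big[\sum_{t=0}^{N_0-1}\mathbf H(\Theta_t,Y_t)1_{\{(Z_t,A_t)=(0,1)\}}\Big]+E^\pi\big[\mathbf H(\Theta_{N_0},Y_{N_0})1_{\{Z_{N_0}=0\}}\big]\Big).$$ Then both suprema are finite and $$\overline{\mathcal H}(\mathbf x,\mathbf y)=\overline{\mathcal H}_{\mathcal M}(\mathbf x,\mathbf y)=\mathfrak B^{N_0}\mathbf H(\delta_{\mathbf x},\mathbf y),$$ where $\mathfrak B f(\theta,y)=\max\{\mathbf H(\theta,y),Sf(\theta,y)\}$, $Sf(\theta,y)=\int f\,dS(\cdot\,|\,\theta,y)$, and $\mathfrak B^{N_0}\mathbf H$ is the $N_0$-th iterate of $\mathfrak B$ applied to $(\theta,y)\mapsto\mathbf H(\theta,y)$. -/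

import Mathlib

open MeasureTheory ProbabilityTheory
open scoped NNReal ENNReal

namespace POStopping

noncomputable section

/-- The σ-algebra `σ{V 0, …, V t}` generated by a process up to time `t`. -/
abbrev pastSigma {N₀ : ℕ} {Ω E : Type*} [MeasurableSpace E]
    (V : Fin (N₀ + 1) → Ω → E) (t : Fin (N₀ + 1)) : MeasurableSpace Ω :=
  ⨆ s ≤ t, MeasurableSpace.comap (V s) inferInstance

/-! ### The partially observed stopping problem -/

/-- A weak control: a filtered probability space carrying a Markov chain `(X, Y)` with transition
kernel `R` relative to the filtration, started at `(x, y)`, and a stopping time `τ` of the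
observation filtration `σ{Y 0, …, Y t}` with values in `{0, …, N₀}`. -/
structure WeakControl.{u, v, w} {𝕏 : Type v} {𝕐 : Type w} [MeasurableSpace 𝕏] [MeasurableSpace 𝕐]
    (R : Kernel (𝕏 × 𝕐) (𝕏 × 𝕐)) (N₀ : ℕ) (x : 𝕏) (y : 𝕐) : Type (max (u + 1) v w) where
  Ξ : Type u
  mΞ : MeasurableSpace Ξ
  Q : Measure Ξ
  isProb : IsProbabilityMeasure Q
  𝒢 : Filtration (Fin (N₀ + 1)) mΞ
  X : Fin (N₀ + 1) → Ξ → 𝕏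
  Y : Fin (N₀ + 1) → Ξ → 𝕐
  adapted_X : ∀ t, Measurable[𝒢 t] (X t)
  adapted_Y : ∀ t, Measurable[𝒢 t] (Y t)
  initial : Q.map (fun ξ => (X 0 ξ, Y 0 ξ)) = Measure.dirac (x, y)
  transition : ∀ (t : Fin N₀) (E : Set (𝕏 × 𝕐)), MeasurableSet E →
    Q⟦(fun ξ => (X t.succ ξ, Y t.succ ξ)) ⁻¹' E | 𝒢 t.castSucc⟧
      =ᵐ[Q] fun ξ => (R (X t.castSucc ξ, Y t.castSucc ξ)).real E
  τ : Ξ → Fin (N₀ + 1)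
  stopping : ∀ t, MeasurableSet[pastSigma Y t] {ξ | τ ξ ≤ t}

section Stopping

variable {𝕏 𝕐 : Type*} [MeasurableSpace 𝕏] [MeasurableSpace 𝕐]

/-- The performance `E[H(X_τ, Y_τ)]` of a weak control. -/
def WeakControl.reward {R : Kernel (𝕏 × 𝕐) (𝕏 × 𝕐)} {N₀ : ℕ} {x : 𝕏} {y : 𝕐}
    (H : 𝕏 × 𝕐 → ℝ) (l : WeakControl R N₀ x y) : ℝ :=
  ∫ ξ, H (l.X (l.τ ξ) ξ, l.Y (l.τ ξ) ξ) ∂l.Q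

end Stopping

/-- The set of all performances of weak controls. -/
def controlRewards.{u, v, w} {𝕏 : Type v} {𝕐 : Type w} [MeasurableSpace 𝕏] [MeasurableSpace 𝕐]
    (R : Kernel (𝕏 × 𝕐) (𝕏 × 𝕐)) (H : 𝕏 × 𝕐 → ℝ) (N₀ : ℕ) (x : 𝕏) (y : 𝕐) : Set ℝ :=
  Set.range fun l : WeakControl.{u, v, w} R N₀ x y => l.reward H

/-- The value of the partially observed stopping problem. -/
def stoppingValue.{u, v, w} {𝕏 : Type v} {𝕐 : Type w} [MeasurableSpace 𝕏] [MeasurableSpace 𝕐]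
    (R : Kernel (𝕏 × 𝕐) (𝕏 × 𝕐)) (H : 𝕏 × 𝕐 → ℝ) (N₀ : ℕ) (x : 𝕏) (y : 𝕐) : ℝ :=
  sSup (controlRewards.{u, v, w} R H N₀ x y)

/-! ### The filter -/

section Filter

variable {𝕏 𝕐 : Type*} [MeasurableSpace 𝕏] [MeasurableSpace 𝕐]

/-- `r(u, v, θ, y) = ∫ r(u, v, x, y) θ(dx)`. -/
def avgDensity (r : 𝕏 × 𝕐 → 𝕏 × 𝕐 → ℝ≥0) (u : 𝕏) (v : 𝕐) (θ : ProbabilityMeasure 𝕏)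
    (y : 𝕐) : ℝ≥0∞ :=
  ∫⁻ x, r (u, v) (x, y) ∂(θ : Measure 𝕏)

/-- `r(λ, v, θ, y) = ∫ r(u, v, θ, y) λ(du)`. -/
def obsDensity (lam : ProbabilityMeasure 𝕏) (r : 𝕏 × 𝕐 → 𝕏 × 𝕐 → ℝ≥0) (v : 𝕐)
    (θ : ProbabilityMeasure 𝕏) (y : 𝕐) : ℝ≥0∞ :=
  ∫⁻ u, avgDensity r u v θ y ∂(lam : Measure 𝕏)

theorem isProbabilityMeasure_bayes {𝕏 𝕐 : Type*} [MeasurableSpace 𝕏]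
    (lam : ProbabilityMeasure 𝕏) (r : 𝕏 × 𝕐 → 𝕏 × 𝕐 → ℝ≥0) (v : 𝕐) (θ : ProbabilityMeasure 𝕏) (y : 𝕐)
    (h : obsDensity lam r v θ y ≠ 0 ∧ obsDensity lam r v θ y ≠ ∞) :
    IsProbabilityMeasure ((lam : Measure 𝕏).withDensity
      fun u => avgDensity r u v θ y / obsDensity lam r v θ y) := by
  refine ⟨?_⟩
  rw [withDensity_apply _ MeasurableSet.univ, Measure.restrict_univ]
  simp only [div_eq_mul_inv]
  rw [lintegral_mul_const' _ _ (ENNReal.inv_ne_top.2 h.1)]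
  exact ENNReal.mul_inv_cancel h.1 h.2

open Classical in
/-- The Bayes operator `Φ(v, θ, y)(du) = r(u, v, θ, y) / r(λ, v, θ, y) λ(du)`. Where the normalizing
constant vanishes the quotient is not defined and `Φ` is given the conventional value `λ`
(the constant is finite as soon as `r` is bounded). -/
def bayes (lam : ProbabilityMeasure 𝕏) (r : 𝕏 × 𝕐 → 𝕏 × 𝕐 → ℝ≥0) (v : 𝕐)
    (θ : ProbabilityMeasure 𝕏) (y : 𝕐) : ProbabilityMeasure 𝕏 :=
  if h : obsDensity lam r v θ y ≠ 0 ∧ obsDensity lam r v θ y ≠ ∞ then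
    ⟨(lam : Measure 𝕏).withDensity fun u => avgDensity r u v θ y / obsDensity lam r v θ y,
      isProbabilityMeasure_bayes lam r v θ y h⟩
  else lam

/-- The measure `R(𝕏, dv | θ, y) = ∫ R(𝕏 × dv | x, y) θ(dx)` on `𝕐`. -/
def obsLaw (R : Kernel (𝕏 × 𝕐) (𝕏 × 𝕐)) (θ : ProbabilityMeasure 𝕏) (y : 𝕐) : Measure 𝕐 :=
  (θ : Measure 𝕏).bind fun x => (R (x, y)).map Prod.snd

/-- `S(B × C | θ, y) = ∫_C δ_{Φ(v, θ, y)}(B) R(𝕏, dv | θ, y)`, that is, the law of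
`(Φ(v, θ, y), v)` when `v` has law `R(𝕏, · | θ, y)`. -/
def filterKernel (R : Kernel (𝕏 × 𝕐) (𝕏 × 𝕐)) (lam : ProbabilityMeasure 𝕏)
    (r : 𝕏 × 𝕐 → 𝕏 × 𝕐 → ℝ≥0) (θ : ProbabilityMeasure 𝕏) (y : 𝕐) :
    Measure (ProbabilityMeasure 𝕏 × 𝕐) :=
  (obsLaw R θ y).map fun v => (bayes lam r v θ y, v)

/-- `H(θ, y) = ∫ H(x, y) θ(dx)`. -/
def avgReward (H : 𝕏 × 𝕐 → ℝ) (q : ProbabilityMeasure 𝕏 × 𝕐) : ℝ :=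
  ∫ x, H (x, q.2) ∂(q.1 : Measure 𝕏)

/-- The Bellman operator `𝔅 f = max {H, S f}`. -/
def bellman (R : Kernel (𝕏 × 𝕐) (𝕏 × 𝕐)) (lam : ProbabilityMeasure 𝕏)
    (r : 𝕏 × 𝕐 → 𝕏 × 𝕐 → ℝ≥0) (H : 𝕏 × 𝕐 → ℝ)
    (f : ProbabilityMeasure 𝕏 × 𝕐 → ℝ) (q : ProbabilityMeasure 𝕏 × 𝕐) : ℝ :=
  max (avgReward H q) (∫ p, f p ∂(filterKernel R lam r q.1 q.2))

/-! ### The completely observed control model -/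

/-- The state space `𝒫(𝕏) × 𝕐 × {0, 1}`. -/
abbrev MState (𝕏 𝕐 : Type*) [MeasurableSpace 𝕏] : Type _ := ProbabilityMeasure 𝕏 × 𝕐 × Fin 2

/-- `Q(B × C × D | θ, y, z, a) = S(B × C | θ, y) [δ_z(D) 1_{a = 0} + δ_1(D) 1_{a = 1}]`. -/
def modelKernel (R : Kernel (𝕏 × 𝕐) (𝕏 × 𝕐)) (lam : ProbabilityMeasure 𝕏)
    (r : 𝕏 × 𝕐 → 𝕏 × 𝕐 → ℝ≥0) (s : MState 𝕏 𝕐) (a : Fin 2) : Measure (MState 𝕏 𝕐) :=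
  ((filterKernel R lam r s.1 s.2.1).prod
    (if a = 0 then Measure.dirac s.2.2 else Measure.dirac 1)).map
      fun q => (q.1.1, q.1.2, q.2)

/-- The reward per stage `H(θ, y, z, a) = H(θ, y) 1_{(z, a) = (0, 1)}`. -/
def stageReward (H : 𝕏 × 𝕐 → ℝ) (s : MState 𝕏 𝕐) (a : Fin 2) : ℝ :=
  if s.2.2 = 0 ∧ a = 1 then avgReward H (s.1, s.2.1) else 0

/-- The terminal reward `h(θ, y, z) = H(θ, y) 1_{z = 0}`. -/
def terminalReward (H : 𝕏 × 𝕐 → ℝ) (s : MState 𝕏 𝕐) : ℝ :=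
  if s.2.2 = 0 then avgReward H (s.1, s.2.1) else 0

/-- A deterministic past dependent policy: `act t` is a measurable `{0, 1}`-valued function of
`(y_0, z_0, a_0, …, y_{t-1}, z_{t-1}, a_{t-1})` and `(y_t, z_t)`. It does not see the filter. -/
structure Policy (𝕐 : Type*) [MeasurableSpace 𝕐] (N₀ : ℕ) where
  act : (t : Fin N₀) → (Fin t → 𝕐 × Fin 2 × Fin 2) × (𝕐 × Fin 2) → Fin 2
  measurable_act : ∀ t, Measurable (act t)

/-- The action `A_t = π_t(Y_0, Z_0, A_0, …, Y_{t-1}, Z_{t-1}, A_{t-1}, Y_t, Z_t)` along a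
trajectory. -/
def Policy.actionAux {N₀ : ℕ} (π : Policy 𝕐 N₀) (ω : Fin (N₀ + 1) → MState 𝕏 𝕐) :
    (t : ℕ) → t < N₀ → Fin 2
  | t, ht => π.act ⟨t, ht⟩
      (fun s : Fin t =>
        ((ω ⟨s, by omega⟩).2.1, (ω ⟨s, by omega⟩).2.2, π.actionAux ω s (by omega)),
        (ω ⟨t, by omega⟩).2)
termination_by t => t

/-- The action process `A_t`, `t < N₀`. -/
def Policy.action {N₀ : ℕ} (π : Policy 𝕐 N₀) (ω : Fin (N₀ + 1) → MState 𝕏 𝕐) (t : Fin N₀) :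
    Fin 2 :=
  π.actionAux ω t t.isLt

/-- The recursion that determines the action process. -/
theorem Policy.action_eq {N₀ : ℕ} (π : Policy 𝕐 N₀) (ω : Fin (N₀ + 1) → MState 𝕏 𝕐)
    (t : Fin N₀) :
    π.action ω t = π.act t
      (fun s : Fin t =>
        ((ω ⟨s, by omega⟩).2.1, (ω ⟨s, by omega⟩).2.2, π.action ω ⟨s, by omega⟩),
        (ω t.castSucc).2) := by
  unfold Policy.action
  rw [Policy.actionAux]
  rfl

/-- `P` is the law on trajectories of the model controlled by `π` and started at `(δ_x, y, 0)`. -/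
structure IsPolicyLaw (R : Kernel (𝕏 × 𝕐) (𝕏 × 𝕐)) (lam : ProbabilityMeasure 𝕏)
    (r : 𝕏 × 𝕐 → 𝕏 × 𝕐 → ℝ≥0) {N₀ : ℕ} (x : 𝕏) (y : 𝕐) (π : Policy 𝕐 N₀)
    (P : Measure (Fin (N₀ + 1) → MState 𝕏 𝕐)) : Prop where
  isProb : IsProbabilityMeasure P
  initial : P.map (fun ω => ω 0)
    = Measure.dirac ((⟨Measure.dirac x, inferInstance⟩ : ProbabilityMeasure 𝕏), y, (0 : Fin 2))
  transition : ∀ (t : Fin N₀) (E : Set (MState 𝕏 𝕐)), MeasurableSet E →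
    P⟦(fun ω => ω t.succ) ⁻¹' E | pastSigma (fun s (ω : Fin (N₀ + 1) → MState 𝕏 𝕐) => ω s)
        t.castSucc⟧
      =ᵐ[P] fun ω => (modelKernel R lam r (ω t.castSucc) (π.action ω t)).real E

/-- The performance of a policy `π` under the law `P`. -/
def Policy.reward {N₀ : ℕ} (H : 𝕏 × 𝕐 → ℝ) (π : Policy 𝕐 N₀)
    (P : Measure (Fin (N₀ + 1) → MState 𝕏 𝕐)) : ℝ :=
  ∫ ω, ∑ t : Fin N₀, stageReward H (ω t.castSucc) (π.action ω t) ∂P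
    + ∫ ω, terminalReward H (ω (Fin.last N₀)) ∂P

/-- The set of all performances of policies. -/
def policyRewards (R : Kernel (𝕏 × 𝕐) (𝕏 × 𝕐)) (lam : ProbabilityMeasure 𝕏)
    (r : 𝕏 × 𝕐 → 𝕏 × 𝕐 → ℝ≥0) (H : 𝕏 × 𝕐 → ℝ) (N₀ : ℕ) (x : 𝕏) (y : 𝕐) : Set ℝ :=
  {c | ∃ (π : Policy 𝕐 N₀) (P : Measure (Fin (N₀ + 1) → MState 𝕏 𝕐)),
    IsPolicyLaw R lam r x y π P ∧ c = π.reward H P}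

/-- The value of the completely observed control model. -/
def modelValue (R : Kernel (𝕏 × 𝕐) (𝕏 × 𝕐)) (lam : ProbabilityMeasure 𝕏)
    (r : 𝕏 × 𝕐 → 𝕏 × 𝕐 → ℝ≥0) (H : 𝕏 × 𝕐 → ℝ) (N₀ : ℕ) (x : 𝕏) (y : 𝕐) : ℝ :=
  sSup (policyRewards R lam r H N₀ x y)

end Filter

end

end POStopping

open POStopping

universe u

/-! Both problems are optimal stopping of one and the same Markov chain, the pair (filter,
observation) with transition law `S`. For such a chain, finite-horizon dynamic programming gives the
value `𝔅^{N₀} H` at the starting point, and the value is attained.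

Hidden side. Bayes' formula (`lintegral_bayes`) and induction over time show that the filter
computed from the observations is the conditional law of the hidden state (`lintegral_filterPath`);
hence the pair is `S`-Markov relative to the observations (`lintegral_filterState_succ`). As `{τ =
t}` is an observation event, `H` at time `τ` may be averaged over the filter
(`integral_stopped_eq_stopPerf`).

Model side. An action changes only the flag, so the pair moves by `S` under every policy. The flag
is almost surely zero exactly until the first action 1, so one reward is collected, at that action
or at the horizon (`IsPolicyLaw.reward_eq_stopPerf`).

Dynamic programming. Both performances become a `stopPerf`, given by decreasing events `B t` ("still
running") with `B (t + 1)` decided at time `t`. One-step Bellman inequalities telescope to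
`stopPerf_le_stopVal`, with equality for the rule that stops once the immediate reward is at least
the continuation value (`stopPerf_eq_stopVal`). A weak control realizes this rule on canonical path
space. A policy can realize it without seeing the filter coordinate, because that coordinate is
almost surely a function of the observations (`IsPolicyLaw.ae_trajState`).

Conditional expectations are turned into joint laws of truncated paths; in that form laws can be
built and compared step by step, which also yields the unique `P^π`. -/

namespace POStopping

noncomputable section

/-! ### Conditional laws and joint laws -/

section JointLaw

variable {Ω S D : Type*} [MeasurableSpace S] [MeasurableSpace D]

/-- Integrating the conditional probability over `W ⁻¹' A` gives the joint law on rectangles. The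
σ-algebra `m` may be strictly larger than `σ(W)`, as it is for the filtration of a weak control. -/
theorem map_prodMk_eq_compProd_of_condExp {m m0 : MeasurableSpace Ω} (hm : m ≤ m0)
    {P : Measure Ω} [IsProbabilityMeasure P] {Z : Ω → S} (hZ : Measurable Z)
    {W : Ω → D} (hW : Measurable[m] W) (κ : Kernel D S) [IsMarkovKernel κ]
    (h : ∀ E, MeasurableSet E → P⟦Z ⁻¹' E | m⟧ =ᵐ[P] fun ω => (κ (W ω)).real E) :
    P.map (fun ω => (W ω, Z ω)) = P.map W ⊗ₘ κ := by
  have hW0 : Measurable W := hW.mono hm le_rfl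
  have : IsProbabilityMeasure (P.map fun ω => (W ω, Z ω)) :=
    Measure.isProbabilityMeasure_map (hW0.prodMk hZ).aemeasurable
  have : IsProbabilityMeasure (P.map W) := Measure.isProbabilityMeasure_map hW0.aemeasurable
  refine Measure.ext_prod fun {A E} hA hE => ?_
  have hmeas : Measurable fun d => κ d E := κ.measurable_coe hE
  rw [Measure.map_apply (hW0.prodMk hZ) (hA.prod hE), Measure.compProd_apply_prod hA hE,
    setLIntegral_map hA hmeas hW0]
  have h1 := setIntegral_condExp (μ := P) (f := (Z ⁻¹' E).indicator fun _ => (1 : ℝ)) hm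
    ((integrable_const _).indicator (hZ hE)) (hW hA)
  rw [setIntegral_congr_ae (hW0 hA) ((h E hE).mono fun _ hx _ => hx),
    setIntegral_indicator (hZ hE), setIntegral_const, smul_eq_mul, mul_one] at h1
  have h2 : ∫ ω in W ⁻¹' A, (κ (W ω)).real E ∂P = (∫⁻ ω in W ⁻¹' A, κ (W ω) E ∂P).toReal :=
    integral_toReal (hmeas.comp hW0).aemeasurable (ae_of_all _ fun _ => measure_lt_top _ _)
  rw [h2] at h1
  -- Finiteness is what permits cancelling `toReal` in `h1`.
  have h3 : ∫⁻ ω in W ⁻¹' A, κ (W ω) E ∂P ≠ ∞ := by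
    refine ne_top_of_le_ne_top (measure_ne_top (P.restrict (W ⁻¹' A)) Set.univ) ?_
    rw [← lintegral_one]
    exact lintegral_mono fun _ => prob_le_one
  exact ((ENNReal.toReal_eq_toReal_iff' h3 (measure_ne_top _ _)).1 h1).symm

/-- Converse direction. Here `m` must be exactly `σ(W)`, since the joint law only tests events of
the form `W ⁻¹' A`. -/
theorem condExp_of_map_prodMk_eq_compProd {m m0 : MeasurableSpace Ω}
    {P : Measure Ω} [IsProbabilityMeasure P] {Z : Ω → S} (hZ : Measurable Z)
    {W : Ω → D} (hW : Measurable W) (hm : m = MeasurableSpace.comap W inferInstance)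
    (κ : Kernel D S) [IsMarkovKernel κ]
    (h : P.map (fun ω => (W ω, Z ω)) = P.map W ⊗ₘ κ) {E : Set S} (hE : MeasurableSet E) :
    P⟦Z ⁻¹' E | m⟧ =ᵐ[P] fun ω => (κ (W ω)).real E := by
  subst hm
  have : IsProbabilityMeasure (P.map W) := Measure.isProbabilityMeasure_map hW.aemeasurable
  have hmeas : Measurable fun d => κ d E := κ.measurable_coe hE
  have hint : Integrable (fun ω => (κ (W ω)).real E) P := by
    refine Integrable.of_bound (hmeas.ennreal_toReal.comp hW).aestronglyMeasurable 1
      (ae_of_all _ fun ω => ?_)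
    rw [Real.norm_of_nonneg measureReal_nonneg]
    exact measureReal_le_one
  refine (ae_eq_condExp_of_forall_setIntegral_eq hW.comap_le
    ((integrable_const _).indicator (hZ hE)) (fun _ _ _ => hint.integrableOn) ?_ ?_).symm
  · rintro _ ⟨A, hA, rfl⟩ -
    have h1 := congrArg (fun μ => μ (A ×ˢ E)) h
    rw [Measure.map_apply (hW.prodMk hZ) (hA.prod hE), Measure.compProd_apply_prod hA hE,
      setLIntegral_map hA hmeas hW] at h1
    have h2 : ∫ ω in W ⁻¹' A, (κ (W ω)).real E ∂P = (∫⁻ ω in W ⁻¹' A, κ (W ω) E ∂P).toReal :=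
      integral_toReal (hmeas.comp hW).aemeasurable (ae_of_all _ fun _ => measure_lt_top _ _)
    rw [h2, ← h1, setIntegral_indicator (hZ hE), setIntegral_const, smul_eq_mul, mul_one]
    rfl
  · exact (hmeas.ennreal_toReal.comp (comap_measurable W)).stronglyMeasurable.aestronglyMeasurable

theorem lintegral_of_map_prodMk_eq_compProd {m0 : MeasurableSpace Ω}
    {P : Measure Ω} [IsProbabilityMeasure P] {Z : Ω → S} (hZ : Measurable Z)
    {W : Ω → D} (hW : Measurable W) (κ : Kernel D S) [IsMarkovKernel κ]
    (h : P.map (fun ω => (W ω, Z ω)) = P.map W ⊗ₘ κ) {G : D × S → ℝ≥0∞} (hG : Measurable G) :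
    ∫⁻ ω, G (W ω, Z ω) ∂P = ∫⁻ ω, ∫⁻ s, G (W ω, s) ∂κ (W ω) ∂P := by
  have : IsProbabilityMeasure (P.map W) := Measure.isProbabilityMeasure_map hW.aemeasurable
  rw [← lintegral_map hG (hW.prodMk hZ), h, Measure.lintegral_compProd hG,
    lintegral_map (f := fun d => ∫⁻ s, G (d, s) ∂κ d) hG.lintegral_kernel_prod_right' hW]

end JointLaw

/-! ### Truncated paths -/

section Trunc

variable {N : ℕ} {S : Type*}

/-- The path stopped being observed after time `t`: later coordinates are reset to the initial
value. -/
def trunc (t : Fin (N + 1)) (ω : Fin (N + 1) → S) : Fin (N + 1) → S :=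
  fun s => if s ≤ t then ω s else ω 0

theorem trunc_apply_of_le {s t : Fin (N + 1)} (h : s ≤ t) (ω : Fin (N + 1) → S) :
    trunc t ω s = ω s := if_pos h

theorem trunc_trunc {s t : Fin (N + 1)} (h : s ≤ t) (ω : Fin (N + 1) → S) :
    trunc s (trunc t ω) = trunc s ω := by
  funext i
  unfold trunc
  split_ifs with h1 h2 h3
  · rfl
  · exact absurd (h1.trans h) h2
  · rfl
  · exact absurd (Fin.zero_le _) h3

theorem trunc_last (ω : Fin (N + 1) → S) : trunc (Fin.last N) ω = ω := by
  funext i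
  exact if_pos (Fin.le_last i)

theorem trunc_zero (ω : Fin (N + 1) → S) : trunc 0 ω = fun _ => ω 0 := by
  funext i
  unfold trunc
  split_ifs with h
  · rw [Fin.le_zero_iff.1 h]
  · rfl

theorem trunc_update (t : Fin N) (ω : Fin (N + 1) → S) (s : S) :
    trunc t.castSucc (Function.update ω t.succ s) = trunc t.castSucc ω := by
  funext i
  unfold trunc
  rw [Function.update_of_ne (Fin.succ_ne_zero t).symm]
  split_ifs with h
  · rw [Function.update_of_ne]
    rintro rfl
    exact absurd h (not_le.2 Fin.castSucc_lt_succ)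
  · rfl

/-- This recursion drives the inductions over time: the past up to `t + 1` is a function of the past
up to `t` and one new coordinate. -/
theorem update_trunc (t : Fin N) (ω : Fin (N + 1) → S) :
    Function.update (trunc t.castSucc ω) t.succ (ω t.succ) = trunc t.succ ω := by
  funext i
  rcases eq_or_ne i t.succ with rfl | hi
  · rw [Function.update_self, trunc_apply_of_le le_rfl]
  · rw [Function.update_of_ne hi]
    unfold trunc
    have : i ≤ t.castSucc ↔ i ≤ t.succ := by
      rw [Fin.le_iff_val_le_val, Fin.le_iff_val_le_val]
      have : (i : ℕ) ≠ t + 1 := fun h => hi (Fin.ext h)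
      simp only [Fin.val_castSucc, Fin.val_succ]
      omega
    simp only [this]

theorem measurable_trunc [MeasurableSpace S] (t : Fin (N + 1)) :
    Measurable (trunc t : (Fin (N + 1) → S) → Fin (N + 1) → S) := by
  refine measurable_pi_iff.2 fun s => ?_
  by_cases h : s ≤ t
  · simpa only [trunc, if_pos h] using! measurable_pi_apply s
  · simpa only [trunc, if_neg h] using! measurable_pi_apply 0

/-- Every past event is thereby a preimage under one map into a path space that does not depend on
`t`. Resetting late coordinates to the initial one needs no default point and adds no information,
time 0 being always in the past. -/
theorem pastSigma_eq_comap {Ω : Type*} [MeasurableSpace S] (V : Fin (N + 1) → Ω → S)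
    (t : Fin (N + 1)) :
    pastSigma V t = MeasurableSpace.comap (fun ω => trunc t fun s => V s ω) inferInstance := by
  apply le_antisymm
  · refine iSup₂_le fun s hs => ?_
    have : V s = (fun h : Fin (N + 1) → S => h s) ∘ fun ω => trunc t fun s => V s ω := by
      funext ω
      exact (trunc_apply_of_le hs fun s => V s ω).symm
    rw [this, ← MeasurableSpace.comap_comp]
    exact MeasurableSpace.comap_mono (measurable_pi_apply s).comap_le
  · rw [← measurable_iff_comap_le, @measurable_pi_iff]
    have key : ∀ s ≤ t, Measurable[pastSigma V t] (V s) := fun s hs =>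
      measurable_iff_comap_le.2 (le_iSup₂_of_le s hs le_rfl)
    intro s
    by_cases h : s ≤ t
    · simpa only [trunc, if_pos h] using key s h
    · simpa only [trunc, if_neg h] using key 0 (Fin.zero_le _)

theorem measurable_pastSigma_trunc {Ω : Type*} [MeasurableSpace S] (V : Fin (N + 1) → Ω → S)
    (t : Fin (N + 1)) : Measurable[pastSigma V t] fun ω => trunc t fun s => V s ω := by
  rw [pastSigma_eq_comap]
  exact comap_measurable _

theorem pastSigma_mono {Ω : Type*} [MeasurableSpace S] (V : Fin (N + 1) → Ω → S) :
    Monotone (pastSigma V) := fun _ _ h =>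
  iSup₂_mono' fun s hs => ⟨s, hs.trans h, le_rfl⟩

theorem pastSigma_le {Ω : Type*} [MeasurableSpace S] {m : MeasurableSpace Ω}
    {V : Fin (N + 1) → Ω → S} {t : Fin (N + 1)} (hV : ∀ s ≤ t, Measurable (V s)) :
    pastSigma V t ≤ m :=
  iSup₂_le fun s hs => (hV s hs).comap_le

end Trunc

/-! ### Laws of finite chains -/

section Chain

variable {N : ℕ} {S : Type*} [MeasurableSpace S]

/-- `P` is the law of a path started at `s₀` whose next coordinate is drawn from `κ t` given the
coordinates up to time `t`. -/
structure IsChainLaw (κ : Fin N → Kernel (Fin (N + 1) → S) S) (s₀ : S)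
    (P : Measure (Fin (N + 1) → S)) : Prop where
  isProb : IsProbabilityMeasure P
  initial : P.map (fun ω => ω 0) = Measure.dirac s₀
  joint : ∀ t : Fin N, P.map (fun ω => (trunc t.castSucc ω, ω t.succ))
    = P.map (trunc t.castSucc) ⊗ₘ κ t

/-- The law of a chain that evolves up to time `t` and rests afterwards. -/
def chainAux (κ : Fin N → Kernel (Fin (N + 1) → S) S) (s₀ : S) :
    Fin (N + 1) → Measure (Fin (N + 1) → S) :=
  fun t => Fin.induction (motive := fun _ => Measure (Fin (N + 1) → S))
    (Measure.dirac fun _ => s₀)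
    (fun t μ => (μ ⊗ₘ κ t).map fun p => Function.update p.1 t.succ p.2) t

variable {κ : Fin N → Kernel (Fin (N + 1) → S) S} {s₀ : S}

theorem chainAux_zero : chainAux κ s₀ 0 = Measure.dirac fun _ => s₀ := rfl

theorem chainAux_succ (t : Fin N) : chainAux κ s₀ t.succ
    = (chainAux κ s₀ t.castSucc ⊗ₘ κ t).map fun p => Function.update p.1 t.succ p.2 := by
  unfold chainAux
  rw [Fin.induction_succ]

theorem measurable_update_snd (t : Fin (N + 1)) :
    Measurable fun p : (Fin (N + 1) → S) × S => Function.update p.1 t p.2 := by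
  refine measurable_pi_iff.2 fun i => ?_
  rcases eq_or_ne i t with rfl | hi
  · simpa only [Function.update_self] using measurable_snd
  · simpa only [Function.update_of_ne hi] using! (measurable_pi_apply i).comp measurable_fst

theorem isProbabilityMeasure_chainAux [∀ t, IsMarkovKernel (κ t)] (t : Fin (N + 1)) :
    IsProbabilityMeasure (chainAux κ s₀ t) := by
  induction t using Fin.induction with
  | zero => rw [chainAux_zero]; infer_instance
  | succ t ih =>
    rw [chainAux_succ]
    exact Measure.isProbabilityMeasure_map (measurable_update_snd _).aemeasurable

/-- Steps after time `s` write only coordinates beyond `s`, and a Markov kernel does not alter the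
first marginal. -/
theorem map_trunc_chainAux [∀ t, IsMarkovKernel (κ t)] {s t : Fin (N + 1)} (h : s ≤ t) :
    (chainAux κ s₀ t).map (trunc s) = (chainAux κ s₀ s).map (trunc s) := by
  induction t using Fin.induction with
  | zero => rw [Fin.le_zero_iff.1 h]
  | succ t ih =>
    rcases h.eq_or_lt with rfl | hlt
    · rfl
    have hs : s ≤ t.castSucc := Fin.le_castSucc_iff.2 hlt
    have := isProbabilityMeasure_chainAux (κ := κ) (s₀ := s₀) t.castSucc
    rw [← ih hs, chainAux_succ, Measure.map_map (measurable_trunc s) (measurable_update_snd _)]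
    have : trunc s ∘ (fun p : (Fin (N + 1) → S) × S => Function.update p.1 t.succ p.2)
        = trunc s ∘ Prod.fst := by
      funext p
      simp only [Function.comp_apply]
      rw [← trunc_trunc hs, trunc_update, trunc_trunc hs]
    rw [this, ← Measure.map_map (measurable_trunc s) measurable_fst]
    congr 1
    exact Measure.fst_compProd _ _

/-- The hypothesis `hκ` says that `κ t` is non-anticipating; it reconciles the construction, which
draws from `κ t` at the whole path, with a joint law stated for the truncated path. -/
theorem isChainLaw_chainAux [∀ t, IsMarkovKernel (κ t)]
    (hκ : ∀ t ω, κ t (trunc t.castSucc ω) = κ t ω) :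
    IsChainLaw κ s₀ (chainAux κ s₀ (Fin.last N)) := by
  have hp := isProbabilityMeasure_chainAux (κ := κ) (s₀ := s₀)
  refine ⟨hp _, ?_, fun t => ?_⟩
  · have h0 : (fun ω : Fin (N + 1) → S => ω 0) = (fun ω => ω 0) ∘ trunc 0 := by
      funext ω; exact (trunc_apply_of_le le_rfl ω).symm
    rw [h0, ← Measure.map_map (measurable_pi_apply 0) (measurable_trunc 0),
      map_trunc_chainAux (Fin.zero_le _),
      Measure.map_map (measurable_pi_apply 0) (measurable_trunc 0), ← h0, chainAux_zero,
      Measure.map_dirac' (measurable_pi_apply 0)]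
  · have hle : t.castSucc ≤ t.succ := Fin.castSucc_lt_succ.le
    have hm : Measurable fun ω : Fin (N + 1) → S => (trunc t.castSucc ω, ω t.succ) :=
      (measurable_trunc _).prodMk (measurable_pi_apply _)
    have h1 : (fun ω : Fin (N + 1) → S => (trunc t.castSucc ω, ω t.succ))
        = (fun ω => (trunc t.castSucc ω, ω t.succ)) ∘ trunc t.succ := by
      funext ω
      simp only [Function.comp_apply, trunc_trunc hle, trunc_apply_of_le le_rfl]
    -- The claim involves only coordinates up to `t + 1`, so the final law may be replaced by the
    -- law at stage `t + 1`.
    rw [h1, ← Measure.map_map hm (measurable_trunc _), map_trunc_chainAux (Fin.le_last _),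
      Measure.map_map hm (measurable_trunc _), ← h1, chainAux_succ,
      Measure.map_map hm (measurable_update_snd _), map_trunc_chainAux (Fin.le_last _)]
    have h2 : (fun ω : Fin (N + 1) → S => (trunc t.castSucc ω, ω t.succ)) ∘
        (fun p : (Fin (N + 1) → S) × S => Function.update p.1 t.succ p.2)
        = Prod.map (trunc t.castSucc) id := by
      funext p
      exact Prod.ext (trunc_update _ _ _) (Function.update_self _ _ _)
    rw [h2]
    have := Measure.isProbabilityMeasure_map (μ := chainAux κ s₀ t.castSucc)
      (measurable_trunc t.castSucc).aemeasurable
    refine Measure.ext_of_lintegral _ fun G hG => ?_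
    rw [lintegral_map hG ((measurable_trunc _).prodMap measurable_id),
      Measure.lintegral_compProd (f := fun p => G (Prod.map (trunc t.castSucc) id p))
        (hG.comp ((measurable_trunc _).prodMap measurable_id)),
      Measure.lintegral_compProd hG,
      lintegral_map hG.lintegral_kernel_prod_right' (measurable_trunc _)]
    simp only [hκ]
    rfl

theorem IsChainLaw.eq [∀ t, IsMarkovKernel (κ t)] {P P' : Measure (Fin (N + 1) → S)}
    (hP : IsChainLaw κ s₀ P) (hP' : IsChainLaw κ s₀ P') : P = P' := by
  have key : ∀ t, P.map (trunc t) = P'.map (trunc t) := by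
    intro t
    induction t using Fin.induction with
    | zero =>
      have h0 : (trunc 0 : (Fin (N + 1) → S) → _) = (fun s _ => s) ∘ fun ω => ω 0 := by
        funext ω; exact trunc_zero ω
      have hc : Measurable fun (s : S) (_ : Fin (N + 1)) => s :=
        measurable_pi_iff.2 fun _ => measurable_id
      rw [h0, ← Measure.map_map hc (measurable_pi_apply 0),
        ← Measure.map_map hc (measurable_pi_apply 0), hP.initial, hP'.initial]
    | succ t ih =>
      have hm : Measurable fun ω : Fin (N + 1) → S => (trunc t.castSucc ω, ω t.succ) :=
        (measurable_trunc _).prodMk (measurable_pi_apply _)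
      have h1 : (trunc t.succ : (Fin (N + 1) → S) → _)
          = (fun p => Function.update p.1 t.succ p.2) ∘
            fun ω => (trunc t.castSucc ω, ω t.succ) := by
        funext ω; exact (update_trunc t ω).symm
      rw [h1, ← Measure.map_map (measurable_update_snd _) hm,
        ← Measure.map_map (measurable_update_snd _) hm, hP.joint, hP'.joint, ih]
  have h := key (Fin.last N)
  have hid : (trunc (Fin.last N) : (Fin (N + 1) → S) → _) = id := by
    funext ω; exact trunc_last ω
  simpa only [hid, Measure.map_id] using h

end Chain

/-! ### Dynamic programming for optimal stopping of a Markov process -/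

section DynamicProgramming

variable {M : Type*} [MeasurableSpace M] (K : Kernel M M) (h : M → ℝ)

/-- The optimal stopping operator `f ↦ max {h, K f}`. -/
def stopOp (f : M → ℝ) (q : M) : ℝ := max (h q) (∫ p, f p ∂K q)

/-- The value of stopping with `k` steps to go. -/
def stopVal (k : ℕ) : M → ℝ := (stopOp K h)^[k] h

theorem stopVal_zero : stopVal K h 0 = h := rfl

theorem stopVal_succ (k : ℕ) : stopVal K h (k + 1) = stopOp K h (stopVal K h k) :=
  Function.iterate_succ_apply' _ _ _

variable {K h}

theorem measurable_integral_kernel [IsMarkovKernel K] {f : M → ℝ} (hf : Measurable f) :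
    Measurable fun q => ∫ p, f p ∂K q :=
  hf.stronglyMeasurable.integral_kernel.measurable

theorem measurable_stopVal [IsMarkovKernel K] (hh : Measurable h) (k : ℕ) :
    Measurable (stopVal K h k) := by
  induction k with
  | zero => exact hh
  | succ k ih =>
    rw [stopVal_succ]
    exact hh.max (measurable_integral_kernel ih)

theorem abs_integral_kernel_le [IsMarkovKernel K] {f : M → ℝ} {C : ℝ} (hf : ∀ q, |f q| ≤ C)
    (q : M) : |∫ p, f p ∂K q| ≤ C := by
  simpa using norm_integral_le_of_norm_le_const (μ := K q)
    (ae_of_all _ fun a => (Real.norm_eq_abs (f a)).trans_le (hf a))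

theorem abs_stopVal_le [IsMarkovKernel K] {C : ℝ} (hC : ∀ q, |h q| ≤ C) (k : ℕ) (q : M) :
    |stopVal K h k q| ≤ C := by
  induction k generalizing q with
  | zero => exact hC q
  | succ k ih =>
    rw [stopVal_succ]
    exact (abs_max_le_max_abs_abs).trans (max_le (hC q) (abs_integral_kernel_le ih q))

variable {Ω : Type*} [MeasurableSpace Ω] {P : Measure Ω} [IsProbabilityMeasure P]

theorem integrable_comp_of_bounded {f : M → ℝ} (hf : Measurable f) {C : ℝ} (hC : ∀ q, |f q| ≤ C)
    {p : Ω → M} (hp : Measurable p) : Integrable (fun ω => f (p ω)) P :=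
  Integrable.of_bound (hf.comp hp).aestronglyMeasurable C (ae_of_all _ fun _ => hC _)

/-- Serves two purposes: with `S` as kernel it is the Markov step, and with `stateKernel` it
replaces the hidden state by its conditional law. -/
theorem setIntegral_of_markov {M' : Type*} [MeasurableSpace M'] {K : Kernel M M'}
    [IsMarkovKernel K] {f : M' → ℝ} (hf : Measurable f) {C : ℝ}
    (hC : ∀ q, |f q| ≤ C) {p : Ω → M} {p' : Ω → M'} (hp : Measurable p) (hp' : Measurable p')
    {B : Set Ω} (hmarkov : (P.restrict B).map p' = K ∘ₘ (P.restrict B).map p) :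
    ∫ ω in B, f (p' ω) ∂P = ∫ ω in B, ∫ q, f q ∂K (p ω) ∂P := by
  have hint : Integrable f (K ∘ₘ (P.restrict B).map p) :=
    Integrable.of_bound hf.aestronglyMeasurable C (ae_of_all _ hC)
  rw [← integral_map hp'.aemeasurable hf.aestronglyMeasurable, hmarkov,
    Measure.comp_eq_comp_const_apply, Kernel.integral_comp, Kernel.const_apply,
    integral_map hp.aemeasurable hf.stronglyMeasurable.integral_kernel.aestronglyMeasurable]
  rwa [← Measure.comp_eq_comp_const_apply]

omit [IsProbabilityMeasure P] in
-- Take `F` to be the indicator of `A ×ˢ E`: the variable `W` carries the past, so the identity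
-- localizes to any past event.
theorem restrict_map_eq_comp_of_lintegral {M' D : Type*} [MeasurableSpace M']
    [MeasurableSpace D] {K : Kernel M M'} {p : Ω → M} {p' : Ω → M'} (hp : Measurable p)
    (hp' : Measurable p') {W : Ω → D} (hW : Measurable W)
    (h : ∀ F : D × M' → ℝ≥0∞, Measurable F →
      ∫⁻ ω, F (W ω, p' ω) ∂P = ∫⁻ ω, ∫⁻ q, F (W ω, q) ∂K (p ω) ∂P)
    {A : Set D} (hA : MeasurableSet A) :
    (P.restrict (W ⁻¹' A)).map p' = K ∘ₘ (P.restrict (W ⁻¹' A)).map p := by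
  ext E hE
  rw [Measure.map_apply hp' hE, Measure.bind_apply hE K.aemeasurable,
    lintegral_map (K.measurable_coe hE) hp, Measure.restrict_apply (hp' hE)]
  have h1 := h ((A ×ˢ E).indicator 1) (measurable_one.indicator (hA.prod hE))
  have h2 : ∀ ω, (A ×ˢ E).indicator (1 : D × M' → ℝ≥0∞) (W ω, p' ω)
      = (p' ⁻¹' E ∩ W ⁻¹' A).indicator 1 ω := fun ω => by
    by_cases hω : W ω ∈ A <;> by_cases hω' : p' ω ∈ E <;>
      simp [Set.indicator, Set.mem_prod, hω, hω']
  have h3 : ∀ ω, ∫⁻ q, (A ×ˢ E).indicator (1 : D × M' → ℝ≥0∞) (W ω, q) ∂K (p ω)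
      = (W ⁻¹' A).indicator (fun ω => K (p ω) E) ω := fun ω => by
    by_cases hω : W ω ∈ A
    · rw [Set.indicator_of_mem (show ω ∈ W ⁻¹' A from hω), ← lintegral_indicator_one hE]
      refine lintegral_congr fun q => ?_
      by_cases hq : q ∈ E <;> simp [Set.indicator, Set.mem_prod, hω, hq]
    · rw [Set.indicator_of_notMem (show ω ∉ W ⁻¹' A from hω)]
      simp [Set.indicator, Set.mem_prod, hω]
  simp only [h2, h3] at h1
  rwa [lintegral_indicator_one ((hp' hE).inter (hW hA)), lintegral_indicator (hW hA)] at h1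

/-- One step of the dynamic programming inequality. -/
theorem setIntegral_add_le_stopOp [IsMarkovKernel K] (hh : Measurable h) {f : M → ℝ}
    (hf : Measurable f) {C : ℝ} (hC : ∀ q, |h q| ≤ C) (hfC : ∀ q, |f q| ≤ C) {p p' : Ω → M}
    (hp : Measurable p) (hp' : Measurable p') {B B' : Set Ω}
    (hB' : MeasurableSet B') (hsub : B' ⊆ B)
    (hmarkov : (P.restrict B').map p' = K ∘ₘ (P.restrict B').map p) :
    ∫ ω in B \ B', h (p ω) ∂P + ∫ ω in B', f (p' ω) ∂P ≤ ∫ ω in B, stopOp K h f (p ω) ∂P := by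
  have hKf := measurable_integral_kernel (K := K) hf
  have hi : Integrable (fun ω => stopOp K h f (p ω)) P :=
    integrable_comp_of_bounded (hh.max hKf)
      (fun q => abs_max_le_max_abs_abs.trans (max_le (hC q) (abs_integral_kernel_le hfC q))) hp
  have h1 : ∫ ω in B, stopOp K h f (p ω) ∂P
      = ∫ ω in B \ B', stopOp K h f (p ω) ∂P + ∫ ω in B', stopOp K h f (p ω) ∂P := by
    rw [← setIntegral_union Set.disjoint_sdiff_left hB' hi.integrableOn hi.integrableOn,
      Set.sdiff_union_of_subset hsub]
  rw [h1, setIntegral_of_markov hf hfC hp hp' hmarkov]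
  refine add_le_add ?_ ?_
  · exact integral_mono (integrable_comp_of_bounded hh hC hp).integrableOn hi.integrableOn
      fun ω => le_max_left _ _
  · exact integral_mono
      (integrable_comp_of_bounded hKf (abs_integral_kernel_le hfC) hp).integrableOn
      hi.integrableOn fun ω => le_max_right _ _

/-- The dynamic programming step is an equality for the optimal decision. -/
theorem setIntegral_add_eq_stopOp [IsMarkovKernel K] (hh : Measurable h) {f : M → ℝ}
    (hf : Measurable f) {C : ℝ} (hC : ∀ q, |h q| ≤ C) (hfC : ∀ q, |f q| ≤ C) {p p' : Ω → M}
    (hp : Measurable p) (hp' : Measurable p') {B B' : Set Ω} (hB : MeasurableSet B)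
    (hB' : MeasurableSet B') (hsub : B' ⊆ B)
    (hmarkov : (P.restrict B').map p' = K ∘ₘ (P.restrict B').map p)
    (hcont : ∀ᵐ ω ∂P, ω ∈ B' → h (p ω) ≤ ∫ q, f q ∂K (p ω))
    (hquit : ∀ᵐ ω ∂P, ω ∈ B \ B' → ∫ q, f q ∂K (p ω) ≤ h (p ω)) :
    ∫ ω in B \ B', h (p ω) ∂P + ∫ ω in B', f (p' ω) ∂P = ∫ ω in B, stopOp K h f (p ω) ∂P := by
  have hKf := measurable_integral_kernel (K := K) hf
  have hi : Integrable (fun ω => stopOp K h f (p ω)) P :=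
    integrable_comp_of_bounded (hh.max hKf)
      (fun q => abs_max_le_max_abs_abs.trans (max_le (hC q) (abs_integral_kernel_le hfC q))) hp
  have h1 : ∫ ω in B, stopOp K h f (p ω) ∂P
      = ∫ ω in B \ B', stopOp K h f (p ω) ∂P + ∫ ω in B', stopOp K h f (p ω) ∂P := by
    rw [← setIntegral_union Set.disjoint_sdiff_left hB' hi.integrableOn hi.integrableOn,
      Set.sdiff_union_of_subset hsub]
  rw [h1, setIntegral_of_markov hf hfC hp hp' hmarkov]
  congr 1
  · exact setIntegral_congr_ae (hB.diff hB') (hquit.mono fun ω hω hmem =>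
      (max_eq_left (hω hmem)).symm)
  · exact setIntegral_congr_ae hB' (hcont.mono fun ω hω hmem => (max_eq_right (hω hmem)).symm)

theorem sum_castSucc_add_last {N : ℕ} (a : Fin (N + 1) → ℝ) :
    ∑ t : Fin N, a t.castSucc + a (Fin.last N) = a 0 + ∑ t : Fin N, a t.succ := by
  rw [← Fin.sum_univ_castSucc, Fin.sum_univ_succ]

/-- The performance of stopping on `B t \ B (t + 1)` at time `t` and on `B N` at time `N`. -/
def stopPerf {N : ℕ} (P : Measure Ω) (h : M → ℝ) (B : Fin (N + 1) → Set Ω)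
    (p : Fin (N + 1) → Ω → M) : ℝ :=
  ∑ t : Fin N, ∫ ω in B t.castSucc \ B t.succ, h (p t.castSucc ω) ∂P
    + ∫ ω in B (Fin.last N), h (p (Fin.last N) ω) ∂P

/-- Since `t < N`, the truncated subtraction satisfies `N - t = (N - (t + 1)) + 1`. -/
theorem stopVal_sub_castSucc {N : ℕ} (t : Fin N) : stopVal K h (N - t.castSucc.val)
    = stopOp K h (stopVal K h (N - t.succ.val)) := by
  rw [← stopVal_succ]
  congr 1
  have := t.isLt
  simp only [Fin.val_castSucc, Fin.val_succ]
  omega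

section Horizon

variable [IsMarkovKernel K] (hh : Measurable h) {C : ℝ} (hC : ∀ q, |h q| ≤ C) {N : ℕ}
  {p : Fin (N + 1) → Ω → M} (hp : ∀ t, Measurable (p t)) {B : Fin (N + 1) → Set Ω}
  (hB : ∀ t, MeasurableSet (B t)) (hB0 : B 0 = Set.univ)
  (hsub : ∀ t : Fin N, B t.succ ⊆ B t.castSucc)
  (hmarkov : ∀ t : Fin N, (P.restrict (B t.succ)).map (p t.succ)
    = K ∘ₘ (P.restrict (B t.succ)).map (p t.castSucc))

include hh hC hp hB hB0 hsub hmarkov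

/-- Let `a t` be the expected value function at time `t` over the paths still running. The reward of
those stopping at `t` plus `a (t + 1)` is at most `a t`; summing telescopes. The Markov property is
needed only on `B (t + 1)`, an event known at time `t` in the applications. -/
theorem stopPerf_le_stopVal : stopPerf P h B p ≤ ∫ ω, stopVal K h N (p 0 ω) ∂P := by
  set a : Fin (N + 1) → ℝ := fun t => ∫ ω in B t, stopVal K h (N - t.val) (p t ω) ∂P with ha
  have hstep : ∀ t : Fin N, ∫ ω in B t.castSucc \ B t.succ, h (p t.castSucc ω) ∂P + a t.succ
      ≤ a t.castSucc := fun t => by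
    simp only [ha, stopVal_sub_castSucc]
    exact setIntegral_add_le_stopOp hh (measurable_stopVal hh _) hC (abs_stopVal_le hC _)
      (hp _) (hp _) (hB _) (hsub t) (hmarkov t)
  have hsum := Finset.sum_le_sum fun t (_ : t ∈ Finset.univ) => hstep t
  rw [Finset.sum_add_distrib] at hsum
  have htel := sum_castSucc_add_last a
  have h0 : a 0 = ∫ ω, stopVal K h N (p 0 ω) ∂P := by simp [ha, hB0]
  have hl : a (Fin.last N) = ∫ ω in B (Fin.last N), h (p (Fin.last N) ω) ∂P := by
    simp [ha, stopVal_zero]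
  rw [stopPerf, ← hl, ← h0]
  linarith

/-- The decision conditions are required only almost everywhere, because a policy agrees with the
optimal rule for the filter coordinate only up to null sets. -/
theorem stopPerf_eq_stopVal
    (hcont : ∀ t : Fin N, ∀ᵐ ω ∂P, ω ∈ B t.succ → h (p t.castSucc ω)
      ≤ ∫ q, stopVal K h (N - t.succ.val) q ∂K (p t.castSucc ω))
    (hquit : ∀ t : Fin N, ∀ᵐ ω ∂P, ω ∈ B t.castSucc \ B t.succ →
      ∫ q, stopVal K h (N - t.succ.val) q ∂K (p t.castSucc ω) ≤ h (p t.castSucc ω)) :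
    stopPerf P h B p = ∫ ω, stopVal K h N (p 0 ω) ∂P := by
  set a : Fin (N + 1) → ℝ := fun t => ∫ ω in B t, stopVal K h (N - t.val) (p t ω) ∂P with ha
  have hstep : ∀ t : Fin N, ∫ ω in B t.castSucc \ B t.succ, h (p t.castSucc ω) ∂P + a t.succ
      = a t.castSucc := fun t => by
    simp only [ha, stopVal_sub_castSucc]
    exact setIntegral_add_eq_stopOp hh (measurable_stopVal hh _) hC (abs_stopVal_le hC _)
      (hp _) (hp _) (hB _) (hB _) (hsub t) (hmarkov t) (hcont t) (hquit t)
  have hsum := Finset.sum_congr rfl fun t (_ : t ∈ Finset.univ) => hstep t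
  rw [Finset.sum_add_distrib] at hsum
  have htel := sum_castSucc_add_last a
  have h0 : a 0 = ∫ ω, stopVal K h N (p 0 ω) ∂P := by simp [ha, hB0]
  have hl : a (Fin.last N) = ∫ ω in B (Fin.last N), h (p (Fin.last N) ω) ∂P := by
    simp [ha, stopVal_zero]
  rw [stopPerf, ← hl, ← h0]
  linarith

end Horizon

end DynamicProgramming

/-! ### Measurability of the filter and Bayes' formula -/

section Bayes

variable {𝕏 𝕐 : Type*} [MeasurableSpace 𝕏] [MeasurableSpace 𝕐]

/-- The identity of the space of probability measures as a kernel. -/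
def evalKernel (𝕏 : Type*) [MeasurableSpace 𝕏] : Kernel (ProbabilityMeasure 𝕏) 𝕏 where
  toFun θ := (θ : Measure 𝕏)
  measurable' := measurable_subtype_coe

instance : IsMarkovKernel (evalKernel 𝕏) := ⟨fun θ => θ.2⟩

theorem measurable_lintegral_probabilityMeasure {D : Type*} [MeasurableSpace D]
    {F : D → 𝕏 → ℝ≥0∞} (hF : Measurable (Function.uncurry F)) {θ : D → ProbabilityMeasure 𝕏}
    (hθ : Measurable θ) : Measurable fun d => ∫⁻ x, F d x ∂(θ d : Measure 𝕏) :=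
  Measurable.lintegral_kernel_prod_right (κ := (evalKernel 𝕏).comap θ hθ) hF

theorem measurable_avgReward {H : 𝕏 × 𝕐 → ℝ} (hH : Measurable H) : Measurable (avgReward H) := by
  have : StronglyMeasurable fun z : (ProbabilityMeasure 𝕏 × 𝕐) × 𝕏 => H (z.2, z.1.2) :=
    (hH.comp (measurable_snd.prodMk (measurable_snd.comp measurable_fst))).stronglyMeasurable
  exact (this.integral_kernel_prod_right'
    (κ := (evalKernel 𝕏).comap Prod.fst measurable_fst)).measurable

omit [MeasurableSpace 𝕐] in
theorem abs_avgReward_le {H : 𝕏 × 𝕐 → ℝ} {C : ℝ} (hC : ∀ p, |H p| ≤ C)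
    (q : ProbabilityMeasure 𝕏 × 𝕐) : |avgReward H q| ≤ C := by
  simpa [avgReward] using norm_integral_le_of_norm_le_const (μ := (q.1 : Measure 𝕏))
    (ae_of_all _ fun x => (Real.norm_eq_abs (H (x, q.2))).trans_le (hC _))

variable {r : 𝕏 × 𝕐 → 𝕏 × 𝕐 → ℝ≥0} {lam : ProbabilityMeasure 𝕏}

theorem measurable_avgDensity (hr : Measurable fun p : (𝕏 × 𝕐) × (𝕏 × 𝕐) => r p.1 p.2) :
    Measurable fun z : (𝕐 × ProbabilityMeasure 𝕏 × 𝕐) × 𝕏 =>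
      avgDensity r z.2 z.1.1 z.1.2.1 z.1.2.2 := by
  unfold avgDensity
  refine measurable_lintegral_probabilityMeasure (D := (𝕐 × ProbabilityMeasure 𝕏 × 𝕐) × 𝕏)
    (F := fun z x => (r (z.2, z.1.1) (x, z.1.2.2) : ℝ≥0∞)) (θ := fun z => z.1.2.1) ?_ (by fun_prop)
  have hg : Measurable fun w : ((𝕐 × ProbabilityMeasure 𝕏 × 𝕐) × 𝕏) × 𝕏 =>
    (((w.1.2, w.1.1.1), (w.2, w.1.1.2.2)) : (𝕏 × 𝕐) × (𝕏 × 𝕐)) := by fun_prop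
  exact (hr.comp hg).coe_nnreal_ennreal

theorem measurable_obsDensity (hr : Measurable fun p : (𝕏 × 𝕐) × (𝕏 × 𝕐) => r p.1 p.2) :
    Measurable fun z : 𝕐 × ProbabilityMeasure 𝕏 × 𝕐 => obsDensity lam r z.1 z.2.1 z.2.2 :=
  (measurable_avgDensity hr).lintegral_prod_right'

omit [MeasurableSpace 𝕐] in
theorem coe_bayes_of_ne {v : 𝕐} {θ : ProbabilityMeasure 𝕏} {y : 𝕐}
    (h : obsDensity lam r v θ y ≠ 0 ∧ obsDensity lam r v θ y ≠ ∞) :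
    (bayes lam r v θ y : Measure 𝕏) = (lam : Measure 𝕏).withDensity
      fun u => avgDensity r u v θ y / obsDensity lam r v θ y :=
  congrArg (fun θ : ProbabilityMeasure 𝕏 => (θ : Measure 𝕏)) (dif_pos h)

/-- It suffices to evaluate on sets `A`. The case distinction is over a measurable set of
parameters, and the density branch is a parametric integral of a jointly measurable quotient. -/
theorem measurable_bayes (hr : Measurable fun p : (𝕏 × 𝕐) × (𝕏 × 𝕐) => r p.1 p.2) :
    Measurable fun z : 𝕐 × ProbabilityMeasure 𝕏 × 𝕐 => bayes lam r z.1 z.2.1 z.2.2 := by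
  classical
  have hobs := measurable_obsDensity (lam := lam) hr
  have hset : MeasurableSet {z : 𝕐 × ProbabilityMeasure 𝕏 × 𝕐 |
      obsDensity lam r z.1 z.2.1 z.2.2 ≠ 0 ∧ obsDensity lam r z.1 z.2.1 z.2.2 ≠ ∞} :=
    ((measurableSet_singleton 0).compl.inter (measurableSet_singleton ∞).compl).preimage hobs
  suffices h : Measurable fun z : 𝕐 × ProbabilityMeasure 𝕏 × 𝕐 =>
      (bayes lam r z.1 z.2.1 z.2.2 : Measure 𝕏) from h.subtype_mk
  refine Measure.measurable_of_measurable_coe _ fun A hA => ?_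
  have heq : (fun z : 𝕐 × ProbabilityMeasure 𝕏 × 𝕐 =>
      (bayes lam r z.1 z.2.1 z.2.2 : Measure 𝕏) A) = fun z =>
      if obsDensity lam r z.1 z.2.1 z.2.2 ≠ 0 ∧ obsDensity lam r z.1 z.2.1 z.2.2 ≠ ∞ then
        ∫⁻ u in A, avgDensity r u z.1 z.2.1 z.2.2 / obsDensity lam r z.1 z.2.1 z.2.2
          ∂(lam : Measure 𝕏)
      else (lam : Measure 𝕏) A := by
    funext z
    by_cases h : obsDensity lam r z.1 z.2.1 z.2.2 ≠ 0 ∧ obsDensity lam r z.1 z.2.1 z.2.2 ≠ ∞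
    · rw [if_pos h, coe_bayes_of_ne h]
      exact withDensity_apply _ hA
    · rw [if_neg h]
      exact congrArg (fun θ : ProbabilityMeasure 𝕏 => (θ : Measure 𝕏) A) (dif_neg h)
  rw [heq]
  refine Measurable.ite hset ?_ measurable_const
  exact Measurable.lintegral_prod_right' (f := fun w : (𝕐 × ProbabilityMeasure 𝕏 × 𝕐) × 𝕏 =>
    avgDensity r w.2 w.1.1 w.1.2.1 w.1.2.2 / obsDensity lam r w.1.1 w.1.2.1 w.1.2.2)
    ((measurable_avgDensity hr).div (hobs.comp measurable_fst))

theorem measurable_bayes_comp (hr : Measurable fun p : (𝕏 × 𝕐) × (𝕏 × 𝕐) => r p.1 p.2) {D : Type*}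
    [MeasurableSpace D] {v : D → 𝕐} {θ : D → ProbabilityMeasure 𝕏} {y : D → 𝕐} (hv : Measurable v)
    (hθ : Measurable θ) (hy : Measurable y) :
    Measurable fun d => bayes lam r (v d) (θ d) (y d) :=
  (measurable_bayes hr).comp (hv.prodMk (hθ.prodMk hy))

/-! ### The observation law, the transition kernel of the filter, and Bayes' formula. -/

variable {R : Kernel (𝕏 × 𝕐) (𝕏 × 𝕐)}

theorem measurable_map_snd (y : 𝕐) : Measurable fun x => (R (x, y)).map Prod.snd :=
  (Measure.measurable_map _ measurable_snd).comp (R.measurable.comp measurable_prodMk_right)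

theorem lintegral_obsLaw (θ : ProbabilityMeasure 𝕏) (y : 𝕐) {k : 𝕐 → ℝ≥0∞} (hk : Measurable k) :
    ∫⁻ v, k v ∂obsLaw R θ y = ∫⁻ x, ∫⁻ q, k q.2 ∂(R (x, y)) ∂(θ : Measure 𝕏) := by
  rw [obsLaw, Measure.lintegral_bind (measurable_map_snd y).aemeasurable hk.aemeasurable]
  exact lintegral_congr fun x => lintegral_map hk measurable_snd

theorem measurable_obsLaw : Measurable fun q : ProbabilityMeasure 𝕏 × 𝕐 => obsLaw R q.1 q.2 := by
  refine Measure.measurable_of_measurable_coe _ fun A hA => ?_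
  have heq : (fun q : ProbabilityMeasure 𝕏 × 𝕐 => obsLaw R q.1 q.2 A)
      = fun q => ∫⁻ x, R (x, q.2) (Prod.snd ⁻¹' A) ∂(q.1 : Measure 𝕏) := by
    funext q
    rw [obsLaw, Measure.bind_apply hA (measurable_map_snd q.2).aemeasurable]
    exact lintegral_congr fun x => Measure.map_apply measurable_snd hA
  rw [heq]
  refine measurable_lintegral_probabilityMeasure
    (F := fun (q : ProbabilityMeasure 𝕏 × 𝕐) x => R (x, q.2) (Prod.snd ⁻¹' A)) ?_ measurable_fst
  exact (R.measurable_coe (measurable_snd hA)).comp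
    (measurable_snd.prodMk (measurable_snd.comp measurable_fst))

instance isProbabilityMeasure_obsLaw [IsMarkovKernel R] (θ : ProbabilityMeasure 𝕏) (y : 𝕐) :
    IsProbabilityMeasure (obsLaw R θ y) :=
  ⟨by rw [← lintegral_one, lintegral_obsLaw θ y measurable_const]; simp⟩

/-- The law of the next observation as a kernel. -/
def obsKernel (R : Kernel (𝕏 × 𝕐) (𝕏 × 𝕐)) : Kernel (ProbabilityMeasure 𝕏 × 𝕐) 𝕐 where
  toFun q := obsLaw R q.1 q.2
  measurable' := measurable_obsLaw

instance [IsMarkovKernel R] : IsMarkovKernel (obsKernel R) := ⟨fun q => isProbabilityMeasure_obsLaw q.1 q.2⟩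

theorem measurable_bayes_pair (hr : Measurable fun p : (𝕏 × 𝕐) × (𝕏 × 𝕐) => r p.1 p.2) :
    Measurable fun z : (ProbabilityMeasure 𝕏 × 𝕐) × 𝕐 =>
      (bayes lam r z.2 z.1.1 z.1.2, z.2) := by
  have h : Measurable fun z : (ProbabilityMeasure 𝕏 × 𝕐) × 𝕐 => (z.2, z.1.1, z.1.2) := by
    fun_prop
  exact ((measurable_bayes hr).comp h).prodMk measurable_snd

theorem lintegral_filterKernel (hr : Measurable fun p : (𝕏 × 𝕐) × (𝕏 × 𝕐) => r p.1 p.2)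
    (θ : ProbabilityMeasure 𝕏) (y : 𝕐) {F : ProbabilityMeasure 𝕏 × 𝕐 → ℝ≥0∞}
    (hF : Measurable F) :
    ∫⁻ p, F p ∂filterKernel R lam r θ y = ∫⁻ v, F (bayes lam r v θ y, v) ∂obsLaw R θ y :=
  lintegral_map hF ((measurable_bayes_pair hr).comp (measurable_prodMk_left (x := (θ, y))))

theorem measurable_filterKernel [IsMarkovKernel R] (hr : Measurable fun p : (𝕏 × 𝕐) × (𝕏 × 𝕐) => r p.1 p.2) :
    Measurable fun q : ProbabilityMeasure 𝕏 × 𝕐 => filterKernel R lam r q.1 q.2 := by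
  refine Measure.measurable_of_measurable_coe _ fun A hA => ?_
  have heq : (fun q : ProbabilityMeasure 𝕏 × 𝕐 => filterKernel R lam r q.1 q.2 A) = fun q =>
      obsKernel R q (Prod.mk q ⁻¹' ((fun z : (ProbabilityMeasure 𝕏 × 𝕐) × 𝕐 =>
        (bayes lam r z.2 z.1.1 z.1.2, z.2)) ⁻¹' A)) := by
    funext q
    exact Measure.map_apply ((measurable_bayes_pair hr).comp (measurable_prodMk_left (x := q))) hA
  rw [heq]
  exact Kernel.measurable_kernel_prodMk_left (measurable_bayes_pair hr hA)

/-- The transition law `S` of the filter as a kernel. -/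
def filterK (R : Kernel (𝕏 × 𝕐) (𝕏 × 𝕐)) [IsMarkovKernel R] (lam : ProbabilityMeasure 𝕏)
    (hr : Measurable fun p : (𝕏 × 𝕐) × (𝕏 × 𝕐) => r p.1 p.2) :
    Kernel (ProbabilityMeasure 𝕏 × 𝕐) (ProbabilityMeasure 𝕏 × 𝕐) where
  toFun q := filterKernel R lam r q.1 q.2
  measurable' := measurable_filterKernel hr

instance [IsMarkovKernel R] (hr : Measurable fun p : (𝕏 × 𝕐) × (𝕏 × 𝕐) => r p.1 p.2) :
    IsMarkovKernel (filterK R lam hr) :=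
  ⟨fun q => Measure.isProbabilityMeasure_map
    ((measurable_bayes_pair hr).comp (measurable_prodMk_left (x := q))).aemeasurable⟩

theorem filterK_apply [IsMarkovKernel R] (hr : Measurable fun p : (𝕏 × 𝕐) × (𝕏 × 𝕐) => r p.1 p.2)
    (q : ProbabilityMeasure 𝕏 × 𝕐) : filterK R lam hr q = filterKernel R lam r q.1 q.2 := rfl

/-- Definitional bridge between the abstract stopping operator of the kernel `S` and the Bellman
operator of the theorem. -/
theorem stopVal_filterK [IsMarkovKernel R] (hr : Measurable fun p : (𝕏 × 𝕐) × (𝕏 × 𝕐) => r p.1 p.2)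
    (H : 𝕏 × 𝕐 → ℝ) (k : ℕ) :
    stopVal (filterK R lam hr) (avgReward H) k = (bellman R lam r H)^[k] (avgReward H) := rfl

/-- Tonelli: mixing the densities of `R` over `θ` gives the density `avgDensity` relative to `λ ⊗
ν`. -/
theorem lintegral_transition {nu : ProbabilityMeasure 𝕐}
    (hr : Measurable fun p : (𝕏 × 𝕐) × (𝕏 × 𝕐) => r p.1 p.2)
    (hR : ∀ p, R p = ((lam : Measure 𝕏).prod (nu : Measure 𝕐)).withDensity fun q => r q p)
    (θ : ProbabilityMeasure 𝕏) (y : 𝕐) {k : 𝕏 × 𝕐 → ℝ≥0∞} (hk : Measurable k) :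
    ∫⁻ x, ∫⁻ q, k q ∂(R (x, y)) ∂(θ : Measure 𝕏)
      = ∫⁻ v, ∫⁻ u, avgDensity r u v θ y * k (u, v) ∂(lam : Measure 𝕏) ∂(nu : Measure 𝕐) := by
  have hrx : Measurable fun w : 𝕏 × (𝕏 × 𝕐) => (r w.2 (w.1, y) : ℝ≥0∞) := by
    have hg : Measurable fun w : 𝕏 × (𝕏 × 𝕐) => ((w.2, (w.1, y)) : (𝕏 × 𝕐) × (𝕏 × 𝕐)) := by
      fun_prop
    exact (hr.comp hg).coe_nnreal_ennreal
  have h1 : ∀ x, ∫⁻ q, k q ∂(R (x, y))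
      = ∫⁻ q, r q (x, y) * k q ∂((lam : Measure 𝕏).prod (nu : Measure 𝕐)) := fun x => by
    rw [hR]
    exact lintegral_withDensity_eq_lintegral_mul _
      (hrx.comp (measurable_prodMk_left (x := x))) hk
  simp only [h1]
  rw [lintegral_lintegral_swap (hrx.mul (hk.comp measurable_snd)).aemeasurable]
  have h2 : ∀ q : 𝕏 × 𝕐, ∫⁻ x, r q (x, y) * k q ∂(θ : Measure 𝕏)
      = avgDensity r q.1 q.2 θ y * k q := fun q =>
    lintegral_mul_const _ (hrx.comp measurable_prodMk_right)
  simp only [h2]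
  have hg : Measurable fun q : 𝕏 × 𝕐 => ((q.2, θ, y), q.1) := by fun_prop
  exact lintegral_prod_symm' _ (((measurable_avgDensity hr).comp hg).mul hk)

/-- Bayes' formula: conditionally on the observation, the state is distributed according to the
updated filter. -/
theorem lintegral_bayes {nu : ProbabilityMeasure 𝕐}
    (hr : Measurable fun p : (𝕏 × 𝕐) × (𝕏 × 𝕐) => r p.1 p.2)
    (hR : ∀ p, R p = ((lam : Measure 𝕏).prod (nu : Measure 𝕐)).withDensity fun q => r q p)
    (hfin : ∀ v θ y, obsDensity lam r v θ y ≠ ∞)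
    (θ : ProbabilityMeasure 𝕏) (y : 𝕐) {k : 𝕏 × 𝕐 → ℝ≥0∞} (hk : Measurable k) :
    ∫⁻ x, ∫⁻ q, k q ∂(R (x, y)) ∂(θ : Measure 𝕏)
      = ∫⁻ v, ∫⁻ u, k (u, v) ∂(bayes lam r v θ y : Measure 𝕏) ∂(obsLaw R θ y) := by
  have hk' : Measurable fun v => ∫⁻ u, k (u, v) ∂(bayes lam r v θ y : Measure 𝕏) := by
    refine measurable_lintegral_probabilityMeasure (F := fun v u => k (u, v))
      (hk.comp measurable_swap) ?_
    have hg : Measurable fun v : 𝕐 => (v, θ, y) := by fun_prop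
    exact (measurable_bayes hr).comp hg
  -- Both sides become integrals over `ν`. On the right the integrand depends on `v` alone, so
  -- integrating out `u` leaves the normalizing constant as a factor.
  rw [lintegral_obsLaw θ y hk', lintegral_transition hr hR θ y
      (k := fun q => ∫⁻ u, k (u, q.2) ∂(bayes lam r q.2 θ y : Measure 𝕏))
      (hk'.comp measurable_snd),
    lintegral_transition hr hR θ y hk]
  refine lintegral_congr fun v => ?_
  have havg : Measurable fun u => avgDensity r u v θ y := by
    have hg : Measurable fun u : 𝕏 => ((v, θ, y), u) := by fun_prop
    exact (measurable_avgDensity hr).comp hg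
  rw [lintegral_mul_const (∫⁻ u, k (u, v) ∂(bayes lam r v θ y : Measure 𝕏)) havg]
  change _ = obsDensity lam r v θ y * _
  by_cases h0 : obsDensity lam r v θ y = 0
  -- Where the normalizing constant vanishes, so does the density for `λ`-almost every `u`; both
  -- sides are zero and the conventional value of `Φ` is immaterial.
  · rw [h0, zero_mul]
    have h1 : (fun u => avgDensity r u v θ y) =ᵐ[(lam : Measure 𝕏)] 0 :=
      (lintegral_eq_zero_iff havg).1 h0
    rw [lintegral_congr_ae (g := fun _ => 0) (h1.mono fun u hu => by
      simp only [hu, Pi.zero_apply, zero_mul]), lintegral_zero]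
  · have hb : (bayes lam r v θ y : Measure 𝕏) = (lam : Measure 𝕏).withDensity
        fun u => avgDensity r u v θ y / obsDensity lam r v θ y := coe_bayes_of_ne ⟨h0, hfin v θ y⟩
    have hkv : Measurable fun u => k (u, v) := hk.comp measurable_prodMk_right
    rw [hb, lintegral_withDensity_eq_lintegral_mul _ (havg.div_const _) hkv,
      ← lintegral_const_mul _ ((havg.div_const _).mul hkv)]
    refine lintegral_congr fun u => ?_
    rw [Pi.mul_apply, ← mul_assoc, ENNReal.mul_div_cancel h0 (hfin v θ y)]

/-- The law of the pair (hidden state, observation) given the filter and the observation. -/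
def stateKernel (𝕏 𝕐 : Type*) [MeasurableSpace 𝕏] [MeasurableSpace 𝕐] :
    Kernel (ProbabilityMeasure 𝕏 × 𝕐) (𝕏 × 𝕐) where
  toFun q := (q.1 : Measure 𝕏).map fun x => (x, q.2)
  measurable' := by
    let κ : Kernel (ProbabilityMeasure 𝕏 × 𝕐) 𝕏 := (evalKernel 𝕏).comap Prod.fst measurable_fst
    refine Measure.measurable_of_measurable_coe _ fun A hA => ?_
    have heq : (fun q : ProbabilityMeasure 𝕏 × 𝕐 => (q.1 : Measure 𝕏).map (fun x => (x, q.2)) A)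
        = fun q => κ q (Prod.mk q ⁻¹'
          ((fun z : (ProbabilityMeasure 𝕏 × 𝕐) × 𝕏 => (z.2, z.1.2)) ⁻¹' A)) := by
      funext q
      exact Measure.map_apply measurable_prodMk_right hA
    rw [heq]
    have hg : Measurable fun z : (ProbabilityMeasure 𝕏 × 𝕐) × 𝕏 => (z.2, z.1.2) := by fun_prop
    exact Kernel.measurable_kernel_prodMk_left (κ := κ) (hg hA)

instance : IsMarkovKernel (stateKernel 𝕏 𝕐) :=
  ⟨fun _ => Measure.isProbabilityMeasure_map measurable_prodMk_right.aemeasurable⟩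

theorem lintegral_stateKernel (q : ProbabilityMeasure 𝕏 × 𝕐) {k : 𝕏 × 𝕐 → ℝ≥0∞}
    (hk : Measurable k) :
    ∫⁻ p, k p ∂stateKernel 𝕏 𝕐 q = ∫⁻ x, k (x, q.2) ∂(q.1 : Measure 𝕏) :=
  lintegral_map hk measurable_prodMk_right

theorem integral_stateKernel (q : ProbabilityMeasure 𝕏 × 𝕐) {H : 𝕏 × 𝕐 → ℝ}
    (hH : Measurable H) : ∫ p, H p ∂stateKernel 𝕏 𝕐 q = avgReward H q :=
  integral_map measurable_prodMk_right.aemeasurable hH.aestronglyMeasurable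

/-! ### The filter along a path of observations -/

section FilterPath

variable {N : ℕ}

/-- The filter at time `t`, started from `δ_x`, as a function of the path of observations. -/
def filterPath (lam : ProbabilityMeasure 𝕏) (r : 𝕏 × 𝕐 → 𝕏 × 𝕐 → ℝ≥0) (x : 𝕏) (t : Fin (N + 1)) :
    (Fin (N + 1) → 𝕐) → ProbabilityMeasure 𝕏 :=
  Fin.induction (motive := fun _ => (Fin (N + 1) → 𝕐) → ProbabilityMeasure 𝕏)
    (fun _ => ⟨Measure.dirac x, inferInstance⟩)
    (fun t g h => bayes lam r (h t.succ) (g h) (h t.castSucc)) t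

omit [MeasurableSpace 𝕐] in
theorem filterPath_succ (x : 𝕏) (t : Fin N) (h : Fin (N + 1) → 𝕐) :
    filterPath lam r x t.succ h
      = bayes lam r (h t.succ) (filterPath lam r x t.castSucc h) (h t.castSucc) := by
  rfl

omit [MeasurableSpace 𝕐] in
theorem filterPath_congr (x : 𝕏) {t : Fin (N + 1)} {h h' : Fin (N + 1) → 𝕐}
    (hh : ∀ s ≤ t, h s = h' s) : filterPath lam r x t h = filterPath lam r x t h' := by
  induction t using Fin.induction with
  | zero => rfl
  | succ t ih =>
    have hle : t.castSucc ≤ t.succ := Fin.castSucc_lt_succ.le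
    rw [filterPath_succ, filterPath_succ, ih fun s hs => hh s (hs.trans hle), hh _ le_rfl,
      hh _ hle]

omit [MeasurableSpace 𝕐] in
theorem filterPath_trunc (x : 𝕏) (t : Fin (N + 1)) (h : Fin (N + 1) → 𝕐) :
    filterPath lam r x t (trunc t h) = filterPath lam r x t h :=
  filterPath_congr x fun _ hs => trunc_apply_of_le hs h

theorem measurable_filterPath (hr : Measurable fun p : (𝕏 × 𝕐) × (𝕏 × 𝕐) => r p.1 p.2) (x : 𝕏)
    (t : Fin (N + 1)) : Measurable (filterPath lam r x t) := by
  induction t using Fin.induction with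
  | zero => exact measurable_const
  | succ t ih =>
    have heq : filterPath lam r x t.succ = fun h : Fin (N + 1) → 𝕐 =>
        bayes lam r (h t.succ) (filterPath lam r x t.castSucc h) (h t.castSucc) :=
      funext (filterPath_succ x t)
    rw [heq]
    exact (measurable_bayes hr).comp
      ((measurable_pi_apply _).prodMk (ih.prodMk (measurable_pi_apply _)))

end FilterPath

end Bayes

/-! ### The filter of a partially observed Markov chain -/

section PartialObservation

variable {𝕏 𝕐 : Type*} [MeasurableSpace 𝕏] [MeasurableSpace 𝕐]
  {r : 𝕏 × 𝕐 → 𝕏 × 𝕐 → ℝ≥0} {lam : ProbabilityMeasure 𝕏} {nu : ProbabilityMeasure 𝕐}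
  {R : Kernel (𝕏 × 𝕐) (𝕏 × 𝕐)} [IsMarkovKernel R]
  {N : ℕ} {x : 𝕏} {y : 𝕐} {Ω : Type*} {mΩ : MeasurableSpace Ω} {Q : Measure Ω}
  [IsProbabilityMeasure Q] {X : Fin (N + 1) → Ω → 𝕏} {Y : Fin (N + 1) → Ω → 𝕐}

/-- `(X, Y)` is a Markov chain with kernel `R` started at `(x, y)`, in the form of joint laws of the
observations up to time `t`, the state at time `t` and the pair at time `t + 1`. -/
structure IsObservedChain (R : Kernel (𝕏 × 𝕐) (𝕏 × 𝕐)) (x : 𝕏) (y : 𝕐) (Q : Measure Ω)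
    (X : Fin (N + 1) → Ω → 𝕏) (Y : Fin (N + 1) → Ω → 𝕐) : Prop where
  measurable_X : ∀ t, Measurable (X t)
  measurable_Y : ∀ t, Measurable (Y t)
  initial : Q.map (fun ω => (X 0 ω, Y 0 ω)) = Measure.dirac (x, y)
  lintegral_succ : ∀ (t : Fin N) (G : ((Fin (N + 1) → 𝕐) × 𝕏) × (𝕏 × 𝕐) → ℝ≥0∞), Measurable G →
    ∫⁻ ω, G ((trunc t.castSucc fun s => Y s ω, X t.castSucc ω), (X t.succ ω, Y t.succ ω)) ∂Q
      = ∫⁻ ω, ∫⁻ q, G ((trunc t.castSucc fun s => Y s ω, X t.castSucc ω), q)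
          ∂(R (X t.castSucc ω, Y t.castSucc ω)) ∂Q

/-- The pair (observations up to `t`, hidden state at `t`) is measurable for the filtration at `t`,
and the transition law depends on it alone; this retains just what filtering uses. -/
theorem isObservedChain_of_condExp {𝒢 : Filtration (Fin (N + 1)) mΩ}
    (hX : ∀ t, Measurable[𝒢 t] (X t)) (hY : ∀ t, Measurable[𝒢 t] (Y t))
    (hinit : Q.map (fun ω => (X 0 ω, Y 0 ω)) = Measure.dirac (x, y))
    (htrans : ∀ (t : Fin N) (E : Set (𝕏 × 𝕐)), MeasurableSet E →
      Q⟦(fun ω => (X t.succ ω, Y t.succ ω)) ⁻¹' E | 𝒢 t.castSucc⟧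
        =ᵐ[Q] fun ω => (R (X t.castSucc ω, Y t.castSucc ω)).real E) :
    IsObservedChain R x y Q X Y := by
  have hXm : ∀ t, Measurable (X t) := fun t => (hX t).mono (𝒢.le t) le_rfl
  have hYm : ∀ t, Measurable (Y t) := fun t => (hY t).mono (𝒢.le t) le_rfl
  refine ⟨hXm, hYm, hinit, fun t G hG => ?_⟩
  have hW : Measurable[𝒢 t.castSucc] fun ω =>
      ((trunc t.castSucc fun s => Y s ω), X t.castSucc ω) :=
    Measurable.prodMk ((measurable_pastSigma_trunc Y t.castSucc).mono
      (pastSigma_le fun s hs => (hY s).mono (𝒢.mono hs) le_rfl) le_rfl) (hX _)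
  have hc : Measurable fun d : (Fin (N + 1) → 𝕐) × 𝕏 => (d.2, d.1 t.castSucc) :=
    measurable_snd.prodMk ((measurable_pi_apply _).comp measurable_fst)
  have hκ : ∀ ω, R.comap _ hc ((trunc t.castSucc fun s => Y s ω), X t.castSucc ω)
      = R (X t.castSucc ω, Y t.castSucc ω) := fun ω => by
    simp only [Kernel.comap_apply, trunc_apply_of_le le_rfl]
  have hZ := (hXm t.succ).prodMk (hYm t.succ)
  have hj := map_prodMk_eq_compProd_of_condExp (𝒢.le t.castSucc) hZ hW (R.comap _ hc)
    fun E hE => by simpa only [hκ] using htrans t E hE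
  have h := lintegral_of_map_prodMk_eq_compProd hZ (hW.mono (𝒢.le _) le_rfl) _ hj hG
  simpa only [hκ] using h

/-- The pair (filter, observation) along a path of observations. -/
def filterState (lam : ProbabilityMeasure 𝕏) (r : 𝕏 × 𝕐 → 𝕏 × 𝕐 → ℝ≥0) (x : 𝕏)
    (t : Fin (N + 1)) (h : Fin (N + 1) → 𝕐) : ProbabilityMeasure 𝕏 × 𝕐 :=
  (filterPath lam r x t h, h t)

theorem measurable_filterState (hr : Measurable fun p : (𝕏 × 𝕐) × (𝕏 × 𝕐) => r p.1 p.2) (x : 𝕏)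
    (t : Fin (N + 1)) : Measurable (filterState lam r x t) :=
  (measurable_filterPath hr x t).prodMk (measurable_pi_apply t)

omit [MeasurableSpace 𝕐] in
theorem filterState_congr (x : 𝕏) {t : Fin (N + 1)} {h h' : Fin (N + 1) → 𝕐}
    (hh : ∀ s ≤ t, h s = h' s) : filterState lam r x t h = filterState lam r x t h' :=
  Prod.ext (filterPath_congr x hh) (hh t le_rfl)

omit [MeasurableSpace 𝕐] in
theorem filterState_trunc (x : 𝕏) (t : Fin (N + 1)) (h : Fin (N + 1) → 𝕐) :
    filterState lam r x t (trunc t h) = filterState lam r x t h :=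
  filterState_congr x fun _ hs => trunc_apply_of_le hs h

namespace IsObservedChain

omit [IsMarkovKernel R] [IsProbabilityMeasure Q] in
theorem measurable_path (hc : IsObservedChain R x y Q X Y) :
    Measurable fun ω s => Y s ω := measurable_pi_iff.2 hc.measurable_Y

omit [IsProbabilityMeasure Q] in
/-- If the filter at time `t` is the conditional law of the state given the observations, then the
next pair is governed by Bayes' formula. -/
theorem lintegral_next (hc : IsObservedChain R x y Q X Y)
    (hr : Measurable fun p : (𝕏 × 𝕐) × (𝕏 × 𝕐) => r p.1 p.2)
    (hR : ∀ p, R p = ((lam : Measure 𝕏).prod (nu : Measure 𝕐)).withDensity fun q => r q p)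
    (hfin : ∀ v θ y, obsDensity lam r v θ y ≠ ∞) (t : Fin N)
    (hfilter : ∀ G : (Fin (N + 1) → 𝕐) × 𝕏 → ℝ≥0∞, Measurable G →
      ∫⁻ ω, G (trunc t.castSucc fun s => Y s ω, X t.castSucc ω) ∂Q
        = ∫⁻ ω, ∫⁻ u, G (trunc t.castSucc fun s => Y s ω, u)
          ∂(filterPath lam r x t.castSucc (fun s => Y s ω) : Measure 𝕏) ∂Q)
    {G : (Fin (N + 1) → 𝕐) × (𝕏 × 𝕐) → ℝ≥0∞} (hG : Measurable G) :
    ∫⁻ ω, G (trunc t.castSucc fun s => Y s ω, (X t.succ ω, Y t.succ ω)) ∂Q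
      = ∫⁻ ω, ∫⁻ v, ∫⁻ u, G (trunc t.castSucc fun s => Y s ω, (u, v))
          ∂(bayes lam r v (filterPath lam r x t.castSucc fun s => Y s ω) (Y t.castSucc ω) :
            Measure 𝕏)
          ∂(obsLaw R (filterPath lam r x t.castSucc fun s => Y s ω) (Y t.castSucc ω)) ∂Q := by
  have hg1 : Measurable fun z : ((Fin (N + 1) → 𝕐) × 𝕏) × (𝕏 × 𝕐) => (z.1.1, z.2) := by fun_prop
  rw [hc.lintegral_succ t (fun z => G (z.1.1, z.2)) (hG.comp hg1)]
  have hcm : Measurable fun d : (Fin (N + 1) → 𝕐) × 𝕏 => (d.2, d.1 t.castSucc) :=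
    measurable_snd.prodMk ((measurable_pi_apply _).comp measurable_fst)
  -- After one transition is integrated out, the remaining function of the past and the hidden state
  -- is averaged over the filter.
  have h1 := hfilter (fun d => ∫⁻ q, G (d.1, q) ∂(R (d.2, d.1 t.castSucc)))
    (Measurable.lintegral_kernel_prod_right' (κ := R.comap _ hcm) (hG.comp hg1))
  simp only [trunc_apply_of_le le_rfl] at h1
  rw [h1]
  exact lintegral_congr fun ω => lintegral_bayes hr hR hfin _ _ (hG.comp measurable_prodMk_left)

omit [IsProbabilityMeasure Q] in
/-- The filter is the conditional law of the state given the observations. -/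
theorem lintegral_filterPath (hc : IsObservedChain R x y Q X Y)
    (hr : Measurable fun p : (𝕏 × 𝕐) × (𝕏 × 𝕐) => r p.1 p.2)
    (hR : ∀ p, R p = ((lam : Measure 𝕏).prod (nu : Measure 𝕐)).withDensity fun q => r q p)
    (hfin : ∀ v θ y, obsDensity lam r v θ y ≠ ∞) (t : Fin (N + 1))
    {G : (Fin (N + 1) → 𝕐) × 𝕏 → ℝ≥0∞} (hG : Measurable G) :
    ∫⁻ ω, G (trunc t fun s => Y s ω, X t ω) ∂Q
      = ∫⁻ ω, ∫⁻ u, G (trunc t fun s => Y s ω, u)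
          ∂(filterPath lam r x t (fun s => Y s ω) : Measure 𝕏) ∂Q := by
  induction t using Fin.induction generalizing G with
  | zero =>
    have hXY := (hc.measurable_X 0).prodMk (hc.measurable_Y 0)
    have hconst : Measurable fun (p : 𝕏 × 𝕐) (_ : Fin (N + 1)) => p.2 :=
      measurable_pi_iff.2 fun _ => measurable_snd
    have h1 : ∀ F : 𝕏 × 𝕐 → ℝ≥0∞, Measurable F →
        ∫⁻ ω, F (X 0 ω, Y 0 ω) ∂Q = F (x, y) := fun F hF => by
      rw [← lintegral_map hF hXY, hc.initial, lintegral_dirac' _ hF]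
    have hl : ∀ ω, ∫⁻ u, G (trunc 0 fun s => Y s ω, u)
        ∂(filterPath lam r x 0 (fun s => Y s ω) : Measure 𝕏) = G (trunc 0 fun s => Y s ω, x) :=
      fun ω => lintegral_dirac' _ (hG.comp measurable_prodMk_left)
    simp only [hl]
    simp only [trunc_zero]
    rw [h1 (fun p => G (fun _ => p.2, p.1)) (hG.comp (hconst.prodMk measurable_fst)),
      h1 (fun p => G (fun _ => p.2, x)) (hG.comp (hconst.prodMk measurable_const))]
  | succ t ih =>
    have hstep := fun G hG => hc.lintegral_next (G := G) hr hR hfin t (fun G hG => ih hG) hG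
    have hupd : Measurable fun z : (Fin (N + 1) → 𝕐) × (𝕏 × 𝕐) =>
        Function.update z.1 t.succ z.2.2 :=
      (measurable_update_snd t.succ).comp
        (measurable_fst.prodMk (measurable_snd.comp measurable_snd))
    -- `hstep` is used twice: here for the hidden state itself, and in `hRt` for the same function
    -- already averaged over the updated filter. The second integrand no longer depends on `u`, so
    -- the two right-hand sides coincide.
    have hL := hstep (fun z => G (Function.update z.1 t.succ z.2.2, z.2.1))
      (hG.comp (hupd.prodMk (measurable_fst.comp measurable_snd)))
    have hmeas : Measurable fun z : (Fin (N + 1) → 𝕐) × (𝕏 × 𝕐) =>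
        ∫⁻ u, G (Function.update z.1 t.succ z.2.2, u)
          ∂(bayes lam r z.2.2 (filterPath lam r x t.castSucc z.1) (z.1 t.castSucc) :
            Measure 𝕏) := by
      refine measurable_lintegral_probabilityMeasure
        (F := fun (z : (Fin (N + 1) → 𝕐) × (𝕏 × 𝕐)) u => G (Function.update z.1 t.succ z.2.2, u))
        (hG.comp ((hupd.comp measurable_fst).prodMk measurable_snd)) ?_
      exact measurable_bayes_comp hr (measurable_snd.comp measurable_snd)
        ((measurable_filterPath hr x _).comp measurable_fst)
        ((measurable_pi_apply _).comp measurable_fst)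
    have hRt := hstep _ hmeas
    have hu : ∀ ω, Function.update (trunc t.castSucc fun s => Y s ω) t.succ (Y t.succ ω)
        = trunc t.succ fun s => Y s ω := fun ω => update_trunc t fun s => Y s ω
    simp only [hu, filterPath_trunc, trunc_apply_of_le le_rfl] at hL hRt
    simp only [filterPath_succ]
    rw [hL, hRt]
    refine lintegral_congr fun ω => lintegral_congr fun v => ?_
    rw [lintegral_const, measure_univ, mul_one]

omit [IsProbabilityMeasure Q] in
/-- The pair (filter, observation) is Markov with the transition law `S` relative to the
observations. -/
theorem lintegral_filterState_succ (hc : IsObservedChain R x y Q X Y)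
    (hr : Measurable fun p : (𝕏 × 𝕐) × (𝕏 × 𝕐) => r p.1 p.2)
    (hR : ∀ p, R p = ((lam : Measure 𝕏).prod (nu : Measure 𝕐)).withDensity fun q => r q p)
    (hfin : ∀ v θ y, obsDensity lam r v θ y ≠ ∞) (t : Fin N)
    {F : (Fin (N + 1) → 𝕐) × (ProbabilityMeasure 𝕏 × 𝕐) → ℝ≥0∞} (hF : Measurable F) :
    ∫⁻ ω, F (trunc t.castSucc fun s => Y s ω, filterState lam r x t.succ fun s => Y s ω) ∂Q
      = ∫⁻ ω, ∫⁻ q, F (trunc t.castSucc fun s => Y s ω, q)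
          ∂filterK R lam hr (filterState lam r x t.castSucc fun s => Y s ω) ∂Q := by
  have hmeas : Measurable fun z : (Fin (N + 1) → 𝕐) × (𝕏 × 𝕐) =>
      F (z.1, (bayes lam r z.2.2 (filterPath lam r x t.castSucc z.1) (z.1 t.castSucc), z.2.2)) :=
    hF.comp (measurable_fst.prodMk ((measurable_bayes_comp hr (measurable_snd.comp measurable_snd)
      ((measurable_filterPath hr x _).comp measurable_fst)
      ((measurable_pi_apply _).comp measurable_fst)).prodMk (measurable_snd.comp measurable_snd)))
  -- The test function ignores the hidden state, so the inner integral over the updated filter is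
  -- trivial and only the observation law remains.
  have h := hc.lintegral_next hr hR hfin t
    (fun G hG => hc.lintegral_filterPath hr hR hfin t.castSucc hG) hmeas
  simp only [filterPath_trunc, trunc_apply_of_le le_rfl, lintegral_const, measure_univ,
    mul_one] at h
  simp only [filterState, filterPath_succ]
  rw [h]
  exact lintegral_congr fun ω => (lintegral_filterKernel hr _ _
    (hF.comp (measurable_prodMk_left (x := trunc t.castSucc fun s => Y s ω)))).symm

omit [IsProbabilityMeasure Q] in
theorem lintegral_state (hc : IsObservedChain R x y Q X Y)
    (hr : Measurable fun p : (𝕏 × 𝕐) × (𝕏 × 𝕐) => r p.1 p.2)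
    (hR : ∀ p, R p = ((lam : Measure 𝕏).prod (nu : Measure 𝕐)).withDensity fun q => r q p)
    (hfin : ∀ v θ y, obsDensity lam r v θ y ≠ ∞) (t : Fin (N + 1))
    {F : (Fin (N + 1) → 𝕐) × (𝕏 × 𝕐) → ℝ≥0∞} (hF : Measurable F) :
    ∫⁻ ω, F (trunc t fun s => Y s ω, (X t ω, Y t ω)) ∂Q
      = ∫⁻ ω, ∫⁻ q, F (trunc t fun s => Y s ω, q)
          ∂stateKernel 𝕏 𝕐 (filterState lam r x t fun s => Y s ω) ∂Q := by
  have hm : Measurable fun z : (Fin (N + 1) → 𝕐) × 𝕏 => (z.1, (z.2, z.1 t)) :=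
    measurable_fst.prodMk (measurable_snd.prodMk ((measurable_pi_apply _).comp measurable_fst))
  have h := hc.lintegral_filterPath hr hR hfin t (hF.comp hm)
  simp only [Function.comp_apply, trunc_apply_of_le le_rfl] at h
  rw [h]
  exact lintegral_congr fun ω => (lintegral_stateKernel (filterState lam r x t fun s => Y s ω)
    (hF.comp (measurable_prodMk_left (x := trunc t fun s => Y s ω)))).symm

omit [IsMarkovKernel R] [IsProbabilityMeasure Q] in
theorem integral_filterState_zero (hc : IsObservedChain R x y Q X Y)
    {f : ProbabilityMeasure 𝕏 × 𝕐 → ℝ} (hf : Measurable f) :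
    ∫ ω, f (filterState lam r x 0 fun s => Y s ω) ∂Q
      = f (⟨Measure.dirac x, inferInstance⟩, y) := by
  have hXY := (hc.measurable_X 0).prodMk (hc.measurable_Y 0)
  have hm : Measurable fun p : 𝕏 × 𝕐 =>
      f ((⟨Measure.dirac x, inferInstance⟩ : ProbabilityMeasure 𝕏), p.2) :=
    hf.comp (measurable_const.prodMk measurable_snd)
  have h := integral_map (μ := Q) hXY.aemeasurable hm.aestronglyMeasurable
  rw [hc.initial, integral_dirac' _ _ hm.stronglyMeasurable] at h
  exact h.symm

end IsObservedChain

end PartialObservation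

/-! ### Stopping times of the observations -/

section StoppingTimes

variable {𝕏 𝕐 : Type*} [MeasurableSpace 𝕏] [MeasurableSpace 𝕐]
  {r : 𝕏 × 𝕐 → 𝕏 × 𝕐 → ℝ≥0} {lam : ProbabilityMeasure 𝕏} {nu : ProbabilityMeasure 𝕐}
  {R : Kernel (𝕏 × 𝕐) (𝕏 × 𝕐)} [IsMarkovKernel R] {H : 𝕏 × 𝕐 → ℝ} {C : ℝ}
  {N : ℕ} {x : 𝕏} {y : 𝕐} {Ω : Type*} {mΩ : MeasurableSpace Ω} {Q : Measure Ω}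
  [IsProbabilityMeasure Q] {X : Fin (N + 1) → Ω → 𝕏} {Y : Fin (N + 1) → Ω → 𝕐}
  {τ : Ω → Fin (N + 1)}

omit [MeasurableSpace 𝕏] in
-- The event is the complement of a union of `{τ ≤ s}` with `s < t`, hence already known one step
-- before `t`. Leaving `m` free covers this and the ambient σ-algebra.
theorem measurableSet_le_of_stopping (hτ : ∀ t, MeasurableSet[pastSigma Y t] {ω | τ ω ≤ t})
    {m : MeasurableSpace Ω} {t : Fin (N + 1)} (hm : ∀ s < t, pastSigma Y s ≤ m) :
    MeasurableSet[m] {ω | t ≤ τ ω} := by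
  have heq : {ω | t ≤ τ ω} = (⋃ s, ⋃ _ : s < t, {ω | τ ω ≤ s})ᶜ := by
    ext ω
    simp only [Set.mem_ofPred_eq, Set.mem_compl_iff, Set.mem_iUnion, not_exists, not_le]
    exact ⟨fun h s hs => hs.trans_le h, fun h => not_lt.1 fun hlt => lt_irrefl _ (h _ hlt)⟩
  rw [heq]
  exact (MeasurableSet.iUnion fun s => MeasurableSet.iUnion fun hs => hm s hs _ (hτ s)).compl

/-- The first time at which a predicate that holds at the last time is satisfied. -/
theorem exists_firstTime (D : Fin (N + 1) → Ω → Prop) (hlast : ∀ ω, D (Fin.last N) ω) :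
    ∃ τ : Ω → Fin (N + 1), ∀ ω t, τ ω ≤ t ↔ ∃ s ≤ t, D s ω := by
  classical
  refine ⟨fun ω => (Finset.univ.filter fun t => D t ω).min'
    ⟨Fin.last N, by simpa using hlast ω⟩, fun ω t => ⟨fun h => ⟨_, h, ?_⟩, ?_⟩⟩
  · exact (Finset.mem_filter.1 (Finset.min'_mem (Finset.univ.filter fun t => D t ω) _)).2
  · rintro ⟨s, hs, hD⟩
    exact (Finset.min'_le _ s (by simpa using hD)).trans hs

/-- It is optimal to stop at time `t` with `N - t` steps to go. -/
def StopNow (K : Kernel (ProbabilityMeasure 𝕏 × 𝕐) (ProbabilityMeasure 𝕏 × 𝕐))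
    (h : ProbabilityMeasure 𝕏 × 𝕐 → ℝ) (N t : ℕ) (q : ProbabilityMeasure 𝕏 × 𝕐) : Prop :=
  ∫ p, stopVal K h (N - (t + 1)) p ∂K q ≤ h q

theorem measurableSet_stopNow
    {K : Kernel (ProbabilityMeasure 𝕏 × 𝕐) (ProbabilityMeasure 𝕏 × 𝕐)} [IsMarkovKernel K]
    {h : ProbabilityMeasure 𝕏 × 𝕐 → ℝ} (hh : Measurable h) (N t : ℕ) :
    MeasurableSet {q | StopNow K h N t q} :=
  measurableSet_le (measurable_integral_kernel (measurable_stopVal hh _)) hh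

/-! ### Stopped rewards under partial observation. -/

namespace IsObservedChain

section Markov

variable (hc : IsObservedChain R x y Q X Y)
    (hr : Measurable fun p : (𝕏 × 𝕐) × (𝕏 × 𝕐) => r p.1 p.2)
    (hR : ∀ p, R p = ((lam : Measure 𝕏).prod (nu : Measure 𝕐)).withDensity fun q => r q p)
    (hfin : ∀ v θ y, obsDensity lam r v θ y ≠ ∞)

include hc hr

omit [IsProbabilityMeasure Q] [IsMarkovKernel R] in
theorem measurable_filterState_comp (t : Fin (N + 1)) :
    Measurable fun ω => filterState lam r x t fun s => Y s ω :=
  (measurable_filterState hr x t).comp hc.measurable_path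

omit [IsProbabilityMeasure Q] [IsMarkovKernel R] hr in
theorem pastSigma_le (t : Fin (N + 1)) : pastSigma Y t ≤ mΩ :=
  POStopping.pastSigma_le fun s _ => hc.measurable_Y s

include hR hfin

omit [IsProbabilityMeasure Q] in
theorem restrict_map_filterState (t : Fin N) {B : Set Ω}
    (hB : MeasurableSet[pastSigma Y t.castSucc] B) :
    (Q.restrict B).map (fun ω => filterState lam r x t.succ fun s => Y s ω)
      = filterK R lam hr ∘ₘ
        (Q.restrict B).map (fun ω => filterState lam r x t.castSucc fun s => Y s ω) := by
  rw [pastSigma_eq_comap] at hB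
  obtain ⟨A, hA, rfl⟩ := hB
  exact restrict_map_eq_comp_of_lintegral (hc.measurable_filterState_comp hr _)
    (hc.measurable_filterState_comp hr _) ((measurable_trunc _).comp hc.measurable_path)
    (fun F hF => hc.lintegral_filterState_succ hr hR hfin t hF) hA

theorem setIntegral_state (hH : Measurable H) (hC : ∀ p, |H p| ≤ C) (t : Fin (N + 1)) {B : Set Ω}
    (hB : MeasurableSet[pastSigma Y t] B) :
    ∫ ω in B, H (X t ω, Y t ω) ∂Q
      = ∫ ω in B, avgReward H (filterState lam r x t fun s => Y s ω) ∂Q := by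
  rw [pastSigma_eq_comap] at hB
  obtain ⟨A, hA, rfl⟩ := hB
  have hXY := (hc.measurable_X t).prodMk (hc.measurable_Y t)
  have h := restrict_map_eq_comp_of_lintegral (hc.measurable_filterState_comp hr t) hXY
    ((measurable_trunc t).comp hc.measurable_path)
    (fun F hF => hc.lintegral_state hr hR hfin t hF) hA
  have h' := setIntegral_of_markov hH hC (hc.measurable_filterState_comp hr t) hXY h
  simp only [integral_stateKernel _ hH] at h'
  exact h'

/-- Split over `{τ = t}`. Each piece is an observation event at time `t`, so `setIntegral_state`
replaces the hidden state by the filter there. -/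
theorem integral_stopped_eq_stopPerf (hH : Measurable H) (hC : ∀ p, |H p| ≤ C)
    (hτ : ∀ t, MeasurableSet[pastSigma Y t] {ω | τ ω ≤ t}) :
    ∫ ω, H (X (τ ω) ω, Y (τ ω) ω) ∂Q
      = stopPerf Q (avgReward H) (fun t => {ω | t ≤ τ ω})
        (fun t ω => filterState lam r x t fun s => Y s ω) := by
  have heqm : ∀ t, MeasurableSet[pastSigma Y t] {ω | τ ω = t} := fun t => by
    have : {ω | τ ω = t} = {ω | τ ω ≤ t} ∩ {ω | t ≤ τ ω} := by
      ext ω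
      exact le_antisymm_iff
    rw [this]
    exact (hτ t).inter (measurableSet_le_of_stopping hτ fun s hs => pastSigma_mono Y hs.le)
  have hint : ∀ t, Integrable (fun ω => H (X t ω, Y t ω)) Q := fun t =>
    integrable_comp_of_bounded hH hC ((hc.measurable_X t).prodMk (hc.measurable_Y t))
  have hsum : ∀ ω, H (X (τ ω) ω, Y (τ ω) ω)
      = ∑ t, {ω | τ ω = t}.indicator (fun ω => H (X t ω, Y t ω)) ω := fun ω => by
    rw [Finset.sum_eq_single (τ ω)]
    · simp
    · intro t _ ht
      simp [ht.symm]
    · simp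
  simp only [hsum]
  rw [integral_finsetSum _ fun t _ => (hint t).indicator (hc.pastSigma_le t _ (heqm t))]
  simp only [integral_indicator (hc.pastSigma_le _ _ (heqm _)),
    hc.setIntegral_state hr hR hfin hH hC _ (heqm _)]
  rw [Fin.sum_univ_castSucc, stopPerf]
  congr 1
  · refine Finset.sum_congr rfl fun t _ => ?_
    have : {ω | t.castSucc ≤ τ ω} \ {ω | t.succ ≤ τ ω} = {ω | τ ω = t.castSucc} := by
      ext ω
      simp only [Set.mem_sdiff, Set.mem_ofPred_eq, not_le,
        Fin.le_iff_val_le_val, Fin.ext_iff, Fin.val_succ, Fin.val_castSucc]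
      omega
    rw [this]
  · have : {ω | Fin.last N ≤ τ ω} = {ω | τ ω = Fin.last N} := by
      ext ω
      exact Fin.last_le_iff
    rw [this]

/-- No stopping time of the observations does better than the value function. -/
theorem integral_stopped_le (hH : Measurable H) (hC : ∀ p, |H p| ≤ C)
    (hτ : ∀ t, MeasurableSet[pastSigma Y t] {ω | τ ω ≤ t}) :
    ∫ ω, H (X (τ ω) ω, Y (τ ω) ω) ∂Q
      ≤ stopVal (filterK R lam hr) (avgReward H) N (⟨Measure.dirac x, inferInstance⟩, y) := by
  have hm := measurable_avgReward hH
  rw [hc.integral_stopped_eq_stopPerf hr hR hfin hH hC hτ,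
    ← hc.integral_filterState_zero (lam := lam) (r := r) (measurable_stopVal hm N)]
  exact stopPerf_le_stopVal hm (abs_avgReward_le hC) (hc.measurable_filterState_comp hr)
    (fun t => measurableSet_le_of_stopping hτ fun s _ => hc.pastSigma_le s)
    (Set.eq_univ_of_forall fun ω => Fin.zero_le _)
    (fun t ω hω => Fin.castSucc_lt_succ.le.trans hω)
    (fun t => hc.restrict_map_filterState hr hR hfin t
      (measurableSet_le_of_stopping hτ fun s hs => pastSigma_mono Y (Fin.le_castSucc_iff.2 hs)))

/-- Stopping as soon as it is optimal attains the value function. -/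
theorem exists_optimal_stopping (hH : Measurable H) (hC : ∀ p, |H p| ≤ C) :
    ∃ τ : Ω → Fin (N + 1), (∀ t, MeasurableSet[pastSigma Y t] {ω | τ ω ≤ t}) ∧
      ∫ ω, H (X (τ ω) ω, Y (τ ω) ω) ∂Q
        = stopVal (filterK R lam hr) (avgReward H) N (⟨Measure.dirac x, inferInstance⟩, y) := by
  have hm := measurable_avgReward hH
  -- The horizon is included so that a first time always exists.
  set D : Fin (N + 1) → Ω → Prop := fun t ω => t = Fin.last N ∨
    StopNow (filterK R lam hr) (avgReward H) N t (filterState lam r x t fun s => Y s ω) with hD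
  obtain ⟨τ, hτD⟩ := exists_firstTime D fun ω => Or.inl rfl
  have hDm : ∀ t, MeasurableSet[pastSigma Y t] {ω | D t ω} := fun t => by
    have : {ω | StopNow (filterK R lam hr) (avgReward H) N t
          (filterState lam r x t fun s => Y s ω)}
        = (fun ω => trunc t fun s => Y s ω) ⁻¹' {h | StopNow (filterK R lam hr) (avgReward H) N t
          (filterState lam r x t h)} := by
      ext ω
      simp only [Set.mem_ofPred_eq, Set.mem_preimage, filterState_trunc]
    have hS : MeasurableSet[pastSigma Y t] {ω | StopNow (filterK R lam hr) (avgReward H) N t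
        (filterState lam r x t fun s => Y s ω)} := by
      rw [this]
      exact measurable_pastSigma_trunc Y t
        (measurable_filterState hr x t (measurableSet_stopNow hm N t))
    exact MeasurableSet.union (MeasurableSet.const _) hS
  have hτ : ∀ t, MeasurableSet[pastSigma Y t] {ω | τ ω ≤ t} := fun t => by
    have : {ω | τ ω ≤ t} = ⋃ s, ⋃ _ : s ≤ t, {ω | D s ω} := by
      ext ω
      simp only [Set.mem_ofPred_eq, hτD, Set.mem_iUnion, exists_prop]
    rw [this]
    exact MeasurableSet.iUnion fun s => MeasurableSet.iUnion fun hs =>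
      pastSigma_mono Y hs _ (hDm s)
  refine ⟨τ, hτ, ?_⟩
  rw [hc.integral_stopped_eq_stopPerf hr hR hfin hH hC hτ,
    ← hc.integral_filterState_zero (lam := lam) (r := r) (measurable_stopVal hm N)]
  refine stopPerf_eq_stopVal hm (abs_avgReward_le hC) (hc.measurable_filterState_comp hr)
    (fun t => measurableSet_le_of_stopping hτ fun s _ => hc.pastSigma_le s)
    (Set.eq_univ_of_forall fun ω => Fin.zero_le _)
    (fun t ω hω => Fin.castSucc_lt_succ.le.trans hω)
    (fun t => hc.restrict_map_filterState hr hR hfin t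
      (measurableSet_le_of_stopping hτ fun s hs => pastSigma_mono Y (Fin.le_castSucc_iff.2 hs)))
    (fun t => ae_of_all _ fun ω hω => ?_) (fun t => ae_of_all _ fun ω hω => ?_)
  -- If stopping were optimal at `t`, then `τ ≤ t`, against `t + 1 ≤ τ`.
  · refine (not_le.1 fun hle => ?_).le
    exact absurd ((hτD ω t.castSucc).2 ⟨_, le_rfl, Or.inr hle⟩)
      (not_le.2 (Fin.castSucc_lt_succ.trans_le hω))
  -- Here `τ = t`, so the criterion holds at `t` itself; as `t` is before the horizon, it holds
  -- through its second alternative.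
  · obtain ⟨s, hs, hDs⟩ := (hτD ω t.castSucc).1 (Fin.le_castSucc_iff.2 (not_le.1 hω.2))
    have hst : s = t.castSucc := le_antisymm hs (hω.1.trans ((hτD ω s).2 ⟨s, le_rfl, hDs⟩))
    subst hst
    exact hDs.resolve_left (Fin.castSucc_lt_last t).ne

end Markov

end IsObservedChain

theorem WeakControl.isObservedChain (l : WeakControl R N x y) :
    IsObservedChain (mΩ := l.mΞ) R x y l.Q l.X l.Y :=
  letI := l.mΞ
  haveI := l.isProb
  isObservedChain_of_condExp l.adapted_X l.adapted_Y l.initial l.transition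

theorem WeakControl.reward_le (l : WeakControl R N x y)
    (hr : Measurable fun p : (𝕏 × 𝕐) × (𝕏 × 𝕐) => r p.1 p.2)
    (hR : ∀ p, R p = ((lam : Measure 𝕏).prod (nu : Measure 𝕐)).withDensity fun q => r q p)
    (hfin : ∀ v θ y, obsDensity lam r v θ y ≠ ∞) (hH : Measurable H) (hC : ∀ p, |H p| ≤ C) :
    l.reward H
      ≤ stopVal (filterK R lam hr) (avgReward H) N (⟨Measure.dirac x, inferInstance⟩, y) :=
  letI := l.mΞ
  haveI := l.isProb
  l.isObservedChain.integral_stopped_le hr hR hfin hH hC l.stopping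

/-- Some weak control attains the value function. -/
theorem exists_weakControl_reward_eq.{w} {𝕏 𝕐 : Type} [MeasurableSpace 𝕏] [MeasurableSpace 𝕐]
    {r : 𝕏 × 𝕐 → 𝕏 × 𝕐 → ℝ≥0} {lam : ProbabilityMeasure 𝕏} {nu : ProbabilityMeasure 𝕐}
    {R : Kernel (𝕏 × 𝕐) (𝕏 × 𝕐)} [IsMarkovKernel R] {H : 𝕏 × 𝕐 → ℝ} {C : ℝ} {N : ℕ}
    (x : 𝕏) (y : 𝕐) (hr : Measurable fun p : (𝕏 × 𝕐) × (𝕏 × 𝕐) => r p.1 p.2)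
    (hR : ∀ p, R p = ((lam : Measure 𝕏).prod (nu : Measure 𝕐)).withDensity fun q => r q p)
    (hfin : ∀ v θ y, obsDensity lam r v θ y ≠ ∞) (hH : Measurable H) (hC : ∀ p, |H p| ≤ C) :
    ∃ l : WeakControl.{w, 0, 0} R N x y, l.reward H
      = stopVal (filterK R lam hr) (avgReward H) N (⟨Measure.dirac x, inferInstance⟩, y) := by
  let κ : Fin N → Kernel (Fin (N + 1) → 𝕏 × 𝕐) (𝕏 × 𝕐) := fun t =>
    R.comap (fun ω => ω t.castSucc) (measurable_pi_apply _)
  have hκ : ∀ t ω, κ t (trunc t.castSucc ω) = κ t ω := fun t ω =>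
    congrArg R (trunc_apply_of_le le_rfl ω)
  have : ∀ t, IsMarkovKernel (κ t) := fun t => inferInstance
  let P := chainAux κ (x, y) (Fin.last N)
  have hP : IsChainLaw κ (x, y) P := isChainLaw_chainAux hκ
  have := hP.isProb
  -- Canonical path space with its natural filtration, lifted to the universe in which weak controls
  -- are taken.
  let Ξ := ULift.{w} (Fin (N + 1) → 𝕏 × 𝕐)
  let V : Fin (N + 1) → Ξ → 𝕏 × 𝕐 := fun s ξ => ξ.down s
  have hV : ∀ s, Measurable (V s) := fun s => (measurable_pi_apply s).comp measurable_down
  let Q : Measure Ξ := P.map ULift.up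
  have hQ : IsProbabilityMeasure Q := Measure.isProbabilityMeasure_map measurable_up.aemeasurable
  let 𝒢 : Filtration (Fin (N + 1)) (inferInstance : MeasurableSpace Ξ) :=
    ⟨pastSigma V, pastSigma_mono V, fun t => pastSigma_le fun s _ => hV s⟩
  have hVG : ∀ t, Measurable[𝒢 t] (V t) := fun t =>
    measurable_iff_comap_le.2 (le_iSup₂_of_le t le_rfl le_rfl)
  have hinit : Q.map (fun ξ => ((V 0 ξ).1, (V 0 ξ).2)) = Measure.dirac (x, y) := by
    change (P.map ULift.up).map (V 0) = _
    rw [Measure.map_map (hV 0) measurable_up]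
    exact hP.initial
  have htrans : ∀ (t : Fin N) (E : Set (𝕏 × 𝕐)), MeasurableSet E →
      Q⟦(fun ξ => ((V t.succ ξ).1, (V t.succ ξ).2)) ⁻¹' E | 𝒢 t.castSucc⟧
        =ᵐ[Q] fun ξ => (R ((V t.castSucc ξ).1, (V t.castSucc ξ).2)).real E := fun t E hE => by
    have hW : Measurable fun ξ : Ξ => trunc t.castSucc fun s => V s ξ :=
      (measurable_trunc _).comp measurable_down
    have hj : Q.map (fun ξ => (trunc t.castSucc fun s => V s ξ, V t.succ ξ))
        = Q.map (fun ξ => trunc t.castSucc fun s => V s ξ) ⊗ₘ κ t := by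
      change (P.map ULift.up).map _ = (P.map ULift.up).map _ ⊗ₘ κ t
      rw [Measure.map_map (hW.prodMk (hV _)) measurable_up, Measure.map_map hW measurable_up]
      exact hP.joint t
    have h := condExp_of_map_prodMk_eq_compProd (hV t.succ) hW
      (pastSigma_eq_comap V t.castSucc) (κ t) hj hE
    simp only [hκ] at h
    exact h
  have hc : IsObservedChain R x y Q (fun t ξ => (V t ξ).1) (fun t ξ => (V t ξ).2) :=
    isObservedChain_of_condExp (𝒢 := 𝒢) (fun t => measurable_fst.comp (hVG t))
      (fun t => measurable_snd.comp (hVG t)) hinit htrans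
  obtain ⟨τ, hτ, hval⟩ := hc.exists_optimal_stopping hr hR hfin hH hC
  exact ⟨⟨Ξ, inferInstance, Q, hQ, 𝒢, _, _, fun t => measurable_fst.comp (hVG t),
    fun t => measurable_snd.comp (hVG t), hinit, htrans, τ, hτ⟩, hval⟩

end StoppingTimes

/-! ### The completely observed control model -/

section Model

theorem ae_of_map_prodMk_eq_compProd {Ω S D : Type*} [MeasurableSpace S] [MeasurableSpace D]
    {m0 : MeasurableSpace Ω} {P : Measure Ω} [IsProbabilityMeasure P] {Z : Ω → S}
    (hZ : Measurable Z) {W : Ω → D} (hW : Measurable W) {κ : Kernel D S} [IsMarkovKernel κ]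
    (h : P.map (fun ω => (W ω, Z ω)) = P.map W ⊗ₘ κ) {p : D × S → Prop}
    (hp : MeasurableSet {z | p z}) (hae : ∀ d, ∀ᵐ s ∂κ d, p (d, s)) :
    ∀ᵐ ω ∂P, p (W ω, Z ω) := by
  have : IsProbabilityMeasure (P.map W) := Measure.isProbabilityMeasure_map hW.aemeasurable
  refine ae_of_ae_map (hW.prodMk hZ).aemeasurable (p := p) ?_
  rw [h]
  exact Measure.ae_compProd_of_ae_ae hp (ae_of_all _ hae)

/-- Equality of probability measures on a countably generated space is a measurable relation. -/
instance {𝕏 : Type*} [MeasurableSpace 𝕏] [MeasurableSpace.CountablyGenerated 𝕏] :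
    MeasurableEq (ProbabilityMeasure 𝕏) := by
  -- The algebra generated by a countable family is countable and a π-system, so countably many
  -- evaluations separate probability measures.
  set S : Set (Set 𝕏) := generateSetAlgebra (MeasurableSpace.countableGeneratingSet 𝕏)
  have hS : S.Countable :=
    countable_generateSetAlgebra MeasurableSpace.countable_countableGeneratingSet
  have hgen : MeasurableSpace.generateFrom S = ‹MeasurableSpace 𝕏› := by
    rw [generateFrom_generateSetAlgebra_eq, MeasurableSpace.generateFrom_countableGeneratingSet]
  have hmeas : ∀ A ∈ S, MeasurableSet A := fun A hA =>
    hgen ▸ MeasurableSpace.measurableSet_generateFrom hA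
  have hpi : IsPiSystem S := fun A hA B hB _ => isSetAlgebra_generateSetAlgebra.inter_mem hA hB
  have heq : Set.diagonal (ProbabilityMeasure 𝕏)
      = ⋂ A ∈ S, {z | (z.1 : Measure 𝕏) A = (z.2 : Measure 𝕏) A} := by
    ext ⟨θ, θ'⟩
    simp only [Set.mem_diagonal_iff, Set.mem_iInter, Set.mem_ofPred_eq]
    refine ⟨fun h A _ => by rw [h], fun h => Subtype.ext ?_⟩
    have : IsProbabilityMeasure θ.val := θ.2
    exact ext_of_generate_finite S hgen.symm hpi h
      ((measure_univ (μ := (θ : Measure 𝕏))).trans (measure_univ (μ := (θ' : Measure 𝕏))).symm)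
  refine ⟨heq ▸ MeasurableSet.biInter hS fun A hA => ?_⟩
  have hA' : Measurable fun θ : ProbabilityMeasure 𝕏 => (θ : Measure 𝕏) A :=
    (Measure.measurable_coe (hmeas A hA)).comp measurable_subtype_coe
  exact measurableSet_eq_fun (hA'.comp measurable_fst) (hA'.comp measurable_snd)

variable {𝕏 𝕐 : Type*} [MeasurableSpace 𝕏] [MeasurableSpace 𝕐]
  {r : 𝕏 × 𝕐 → 𝕏 × 𝕐 → ℝ≥0} {lam : ProbabilityMeasure 𝕏} {nu : ProbabilityMeasure 𝕐}
  {R : Kernel (𝕏 × 𝕐) (𝕏 × 𝕐)} [IsMarkovKernel R] {H : 𝕏 × 𝕐 → ℝ} {C : ℝ} {N : ℕ} {x : 𝕏} {y : 𝕐}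

/-- The next value of the flag `z` under the action `a`. -/
def nextFlag (z a : Fin 2) : Fin 2 := if a = 0 then z else 1

/-- The transition law of the control model as a kernel. -/
def modelK (R : Kernel (𝕏 × 𝕐) (𝕏 × 𝕐)) [IsMarkovKernel R] (lam : ProbabilityMeasure 𝕏)
    (hr : Measurable fun p : (𝕏 × 𝕐) × (𝕏 × 𝕐) => r p.1 p.2) :
    Kernel (MState 𝕏 𝕐 × Fin 2) (MState 𝕏 𝕐) :=
  (((filterK R lam hr).comap (fun w => (w.1.1, w.1.2.1)) (by fun_prop)) ×ₖ
    Kernel.deterministic (fun w : MState 𝕏 𝕐 × Fin 2 => nextFlag w.1.2.2 w.2)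
      ((measurable_of_finite fun z : Fin 2 × Fin 2 => nextFlag z.1 z.2).comp (by fun_prop :
        Measurable fun w : MState 𝕏 𝕐 × Fin 2 => (w.1.2.2, w.2)))).map
    fun q => (q.1.1, q.1.2, q.2)

theorem measurable_assoc {A B D : Type*} [MeasurableSpace A] [MeasurableSpace B]
    [MeasurableSpace D] : Measurable fun q : (A × B) × D => (q.1.1, q.1.2, q.2) := by fun_prop

instance (hr : Measurable fun p : (𝕏 × 𝕐) × (𝕏 × 𝕐) => r p.1 p.2) :
    IsMarkovKernel (modelK R lam hr) :=
  Kernel.IsMarkovKernel.map _ measurable_assoc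

theorem modelK_apply (hr : Measurable fun p : (𝕏 × 𝕐) × (𝕏 × 𝕐) => r p.1 p.2)
    (s : MState 𝕏 𝕐) (a : Fin 2) : modelK R lam hr (s, a) = modelKernel R lam r s a := by
  rw [modelK, Kernel.map_apply _ measurable_assoc, Kernel.prod_apply, Kernel.comap_apply,
    Kernel.deterministic_apply, modelKernel]
  congr 1
  unfold nextFlag
  split_ifs <;> rfl

/-- The flag moves deterministically, so the product measure is an image of `S`. -/
theorem modelK_eq_map (hr : Measurable fun p : (𝕏 × 𝕐) × (𝕏 × 𝕐) => r p.1 p.2)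
    (s : MState 𝕏 𝕐) (a : Fin 2) : modelK R lam hr (s, a)
      = (filterK R lam hr (s.1, s.2.1)).map fun q => (q.1, q.2, nextFlag s.2.2 a) := by
  rw [modelK, Kernel.map_apply _ measurable_assoc, Kernel.prod_apply, Kernel.comap_apply,
    Kernel.deterministic_apply, Measure.prod_dirac,
    Measure.map_map measurable_assoc measurable_prodMk_right]
  rfl

theorem measurable_withFlag (z : Fin 2) :
    Measurable fun q : ProbabilityMeasure 𝕏 × 𝕐 => (q.1, q.2, z) := by fun_prop

/-! ### Policies and their trajectory laws. -/

namespace Policy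

variable (π : Policy 𝕐 N)

omit [IsMarkovKernel R] in
-- Strong induction, because an action may depend on all earlier actions.
theorem action_congr {t : Fin N} {ω ω' : Fin (N + 1) → MState 𝕏 𝕐}
    (h : ∀ s ≤ t.castSucc, ω s = ω' s) : π.action ω t = π.action ω' t := by
  obtain ⟨t, ht⟩ := t
  induction t using Nat.strong_induction_on with
  | _ t ih =>
    rw [action_eq, action_eq, h _ le_rfl]
    congr 2
    funext s
    have hs : (⟨s, s.isLt.trans ht⟩ : Fin N).castSucc ≤ (⟨t, ht⟩ : Fin N).castSucc :=
      Fin.mk_le_mk.2 s.isLt.le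
    have h1 : ω ⟨s, by omega⟩ = ω' ⟨s, by omega⟩ := h _ hs
    rw [h1, ih s s.isLt _ fun i hi => h i (hi.trans hs)]

theorem action_trunc {s t : Fin N} (hst : s ≤ t) (ω : Fin (N + 1) → MState 𝕏 𝕐) :
    π.action (trunc t.castSucc ω) s = π.action ω s :=
  π.action_congr fun _ hi => trunc_apply_of_le (hi.trans (Fin.castSucc_le_castSucc_iff.2 hst)) ω

theorem measurable_action (t : Fin N) :
    Measurable fun ω : Fin (N + 1) → MState 𝕏 𝕐 => π.action ω t := by
  obtain ⟨t, ht⟩ := t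
  induction t using Nat.strong_induction_on with
  | _ t ih =>
    simp only [action_eq π _ ⟨t, ht⟩]
    refine (π.measurable_act _).comp (Measurable.prodMk (measurable_pi_iff.2 fun s => ?_) ?_)
    · have hs : Measurable fun ω : Fin (N + 1) → MState 𝕏 𝕐 => ω ⟨s, by omega⟩ :=
        measurable_pi_apply _
      exact (measurable_fst.comp (measurable_snd.comp hs)).prodMk
        ((measurable_snd.comp (measurable_snd.comp hs)).prodMk (ih s s.isLt _))
    · exact measurable_snd.comp (measurable_pi_apply _)

/-- The law of the next state given the past under the policy `π`. -/
def stepKernel (R : Kernel (𝕏 × 𝕐) (𝕏 × 𝕐)) [IsMarkovKernel R] (lam : ProbabilityMeasure 𝕏)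
    (hr : Measurable fun p : (𝕏 × 𝕐) × (𝕏 × 𝕐) => r p.1 p.2) (t : Fin N) :
    Kernel (Fin (N + 1) → MState 𝕏 𝕐) (MState 𝕏 𝕐) :=
  (modelK R lam hr).comap (fun ω => (ω t.castSucc, π.action ω t))
    ((measurable_pi_apply _).prodMk (π.measurable_action t))

instance (hr : Measurable fun p : (𝕏 × 𝕐) × (𝕏 × 𝕐) => r p.1 p.2) (t : Fin N) :
    IsMarkovKernel (π.stepKernel R lam hr t) := by
  unfold stepKernel
  infer_instance

theorem stepKernel_apply (hr : Measurable fun p : (𝕏 × 𝕐) × (𝕏 × 𝕐) => r p.1 p.2) (t : Fin N)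
    (ω : Fin (N + 1) → MState 𝕏 𝕐) :
    π.stepKernel R lam hr t ω = modelK R lam hr (ω t.castSucc, π.action ω t) := rfl

theorem stepKernel_trunc (hr : Measurable fun p : (𝕏 × 𝕐) × (𝕏 × 𝕐) => r p.1 p.2) (t : Fin N)
    (ω : Fin (N + 1) → MState 𝕏 𝕐) :
    π.stepKernel R lam hr t (trunc t.castSucc ω) = π.stepKernel R lam hr t ω := by
  rw [stepKernel_apply, stepKernel_apply, trunc_apply_of_le le_rfl, π.action_trunc le_rfl]

/-- Once past actions are expressed through the trajectory, a controlled process is a chain with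
history-dependent kernels; existence and uniqueness are then those of chain laws. -/
theorem isPolicyLaw_iff (hr : Measurable fun p : (𝕏 × 𝕐) × (𝕏 × 𝕐) => r p.1 p.2)
    {P : Measure (Fin (N + 1) → MState 𝕏 𝕐)} :
    IsPolicyLaw R lam r x y π P ↔ IsChainLaw (π.stepKernel R lam hr)
      ((⟨Measure.dirac x, inferInstance⟩ : ProbabilityMeasure 𝕏), y, (0 : Fin 2)) P := by
  have hV : ∀ s : Fin (N + 1), Measurable fun ω : Fin (N + 1) → MState 𝕏 𝕐 => ω s :=
    measurable_pi_apply
  have hκ : ∀ t ω, π.stepKernel R lam hr t (trunc t.castSucc ω)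
      = modelKernel R lam r (ω t.castSucc) (π.action ω t) := fun t ω => by
    rw [stepKernel_trunc, stepKernel_apply, modelK_apply]
  constructor
  · intro h
    have := h.isProb
    refine ⟨h.isProb, h.initial, fun t => ?_⟩
    refine map_prodMk_eq_compProd_of_condExp (pastSigma_le fun s _ => hV s) (hV _)
      (measurable_pastSigma_trunc (fun s (ω : Fin (N + 1) → MState 𝕏 𝕐) => ω s) t.castSucc)
      (π.stepKernel R lam hr t) fun E hE => ?_
    simp only [hκ]
    exact h.transition t E hE
  · intro h
    have := h.isProb
    refine ⟨h.isProb, h.initial, fun t E hE => ?_⟩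
    have h' := condExp_of_map_prodMk_eq_compProd (hV t.succ) (measurable_trunc t.castSucc)
      (pastSigma_eq_comap (fun s (ω : Fin (N + 1) → MState 𝕏 𝕐) => ω s) t.castSucc)
      (π.stepKernel R lam hr t) (h.joint t) hE
    simp only [hκ] at h'
    exact h'

/-- Every policy determines exactly one law on trajectories. -/
theorem existsUnique_law (hr : Measurable fun p : (𝕏 × 𝕐) × (𝕏 × 𝕐) => r p.1 p.2) :
    ∃! P, IsPolicyLaw R lam r x y π P := by
  simp only [π.isPolicyLaw_iff hr]
  exact ⟨_, isChainLaw_chainAux (π.stepKernel_trunc hr), fun P hP =>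
    hP.eq (isChainLaw_chainAux (π.stepKernel_trunc hr))⟩

/-- No action has been taken before time `t`. -/
def aliveSet (t : Fin (N + 1)) : Set (Fin (N + 1) → MState 𝕏 𝕐) :=
  {ω | ∀ s : Fin N, s.castSucc < t → π.action ω s = 0}

theorem measurableSet_aliveSet (t : Fin (N + 1)) :
    MeasurableSet (π.aliveSet t : Set (Fin (N + 1) → MState 𝕏 𝕐)) := by
  have : (π.aliveSet t : Set (Fin (N + 1) → MState 𝕏 𝕐))
      = ⋂ s : Fin N, ⋂ _ : s.castSucc < t, {ω | π.action ω s = 0} := by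
    ext ω
    simp only [aliveSet, Set.mem_ofPred_eq, Set.mem_iInter]
  rw [this]
  exact MeasurableSet.iInter fun s => MeasurableSet.iInter fun _ =>
    π.measurable_action s (measurableSet_singleton 0)

theorem mem_aliveSet_succ {t : Fin N} {ω : Fin (N + 1) → MState 𝕏 𝕐} :
    ω ∈ π.aliveSet t.succ ↔ ω ∈ π.aliveSet t.castSucc ∧ π.action ω t = 0 := by
  simp only [aliveSet, Set.mem_ofPred_eq, Fin.castSucc_lt_succ_iff, Fin.castSucc_lt_castSucc_iff]
  refine ⟨fun h => ⟨fun s hs => h s hs.le, h t le_rfl⟩, fun h s hs => ?_⟩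
  rcases hs.eq_or_lt with rfl | hlt
  · exact h.2
  · exact h.1 s hlt

/-- Survival to `t + 1` is decided by the path up to `t`, which is why the Markov step from `t` may
be restricted to this event. -/
theorem trunc_mem_aliveSet_succ {t : Fin N} {ω : Fin (N + 1) → MState 𝕏 𝕐} :
    trunc t.castSucc ω ∈ π.aliveSet t.succ ↔ ω ∈ π.aliveSet t.succ := by
  simp only [aliveSet, Set.mem_ofPred_eq, Fin.castSucc_lt_succ_iff]
  exact forall_congr' fun s => forall_congr' fun hs => by rw [π.action_trunc hs]

end Policy

/-- The pair (filter, observation) at time `t` of a trajectory. -/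
def trajState (t : Fin (N + 1)) (ω : Fin (N + 1) → MState 𝕏 𝕐) : ProbabilityMeasure 𝕏 × 𝕐 :=
  ((ω t).1, (ω t).2.1)

theorem measurable_trajState (t : Fin (N + 1)) :
    Measurable (trajState t : (Fin (N + 1) → MState 𝕏 𝕐) → _) := by
  have h : Measurable fun ω : Fin (N + 1) → MState 𝕏 𝕐 => ω t := measurable_pi_apply t
  exact (measurable_fst.comp h).prodMk (measurable_fst.comp (measurable_snd.comp h))

/-! ### The model under a fixed policy. -/

namespace IsPolicyLaw

variable {π : Policy 𝕐 N} {P : Measure (Fin (N + 1) → MState 𝕏 𝕐)}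

omit [IsMarkovKernel R] in
theorem ae_zero (hP : IsPolicyLaw R lam r x y π P) {E : Set (MState 𝕏 𝕐)} (hE : MeasurableSet E)
    (h : ((⟨Measure.dirac x, inferInstance⟩ : ProbabilityMeasure 𝕏), y, (0 : Fin 2)) ∈ E) :
    ∀ᵐ ω ∂P, ω 0 ∈ E := by
  have h0 : Measurable fun ω : Fin (N + 1) → MState 𝕏 𝕐 => ω 0 := measurable_pi_apply 0
  refine ae_of_ae_map h0.aemeasurable (p := fun s => s ∈ E) ?_
  rw [hP.initial]
  exact (ae_dirac_iff hE).2 h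

/-- A transition always produces a triple (updated filter, observation, updated flag), so a relation
valid for all such triples holds almost surely. It identifies both the flag and the filter along
trajectories. -/
theorem ae_succ (hP : IsPolicyLaw R lam r x y π P)
    (hr : Measurable fun p : (𝕏 × 𝕐) × (𝕏 × 𝕐) => r p.1 p.2) (t : Fin N)
    {p : MState 𝕏 𝕐 → Fin 2 → MState 𝕏 𝕐 → Prop}
    (hp : MeasurableSet {z : (MState 𝕏 𝕐 × Fin 2) × MState 𝕏 𝕐 | p z.1.1 z.1.2 z.2})
    (h : ∀ s a, ∀ v : 𝕐, p s a (bayes lam r v s.1 s.2.1, v, nextFlag s.2.2 a)) :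
    ∀ᵐ ω ∂P, p (ω t.castSucc) (π.action ω t) (ω t.succ) := by
  have hc := (π.isPolicyLaw_iff hr).1 hP
  have := hc.isProb
  have hm : Measurable fun z : (Fin (N + 1) → MState 𝕏 𝕐) × MState 𝕏 𝕐 =>
      ((z.1 t.castSucc, π.action z.1 t), z.2) :=
    (((measurable_pi_apply _).prodMk (π.measurable_action t)).comp measurable_fst).prodMk
      measurable_snd
  have hae := ae_of_map_prodMk_eq_compProd (measurable_pi_apply _) (measurable_trunc _)
    (hc.joint t) (p := fun z => p (z.1 t.castSucc) (π.action z.1 t) z.2) (hm hp) fun d => by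
      rw [π.stepKernel_apply, modelK_eq_map]
      have hps : MeasurableSet {s | p (d t.castSucc) (π.action d t) s} :=
        measurable_prodMk_left (x := (d t.castSucc, π.action d t)) hp
      rw [ae_map_iff (measurable_withFlag _).aemeasurable hps, filterK_apply, filterKernel]
      exact (ae_map_iff ((measurable_bayes_pair hr).comp
        (measurable_prodMk_left (x := ((d t.castSucc).1, (d t.castSucc).2.1)))).aemeasurable
        (measurable_withFlag _ hps)).2 (ae_of_all _ fun v => h _ _ v)
  simpa only [trunc_apply_of_le le_rfl, π.action_trunc le_rfl] using hae

/-- The flag vanishes exactly as long as no action has been taken. -/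
theorem ae_flag (hP : IsPolicyLaw R lam r x y π P)
    (hr : Measurable fun p : (𝕏 × 𝕐) × (𝕏 × 𝕐) => r p.1 p.2) (t : Fin (N + 1)) :
    ∀ᵐ ω ∂P, (ω t).2.2 = 0 ↔ ω ∈ π.aliveSet t := by
  have hflag : Measurable fun s : MState 𝕏 𝕐 => s.2.2 := by fun_prop
  induction t using Fin.induction with
  | zero =>
    filter_upwards [hP.ae_zero (hflag (measurableSet_singleton 0)) rfl] with ω hω
    exact iff_of_true hω fun s hs => absurd hs (Fin.not_lt_zero _)
  | succ t ih =>
    have hset : MeasurableSet {z : (MState 𝕏 𝕐 × Fin 2) × MState 𝕏 𝕐 |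
        z.2.2.2 = nextFlag z.1.1.2.2 z.1.2} :=
      measurableSet_eq_fun (by fun_prop) ((measurable_of_finite fun z : Fin 2 × Fin 2 =>
        nextFlag z.1 z.2).comp (by fun_prop : Measurable
          fun z : (MState 𝕏 𝕐 × Fin 2) × MState 𝕏 𝕐 => (z.1.1.2.2, z.1.2)))
    filter_upwards [ih, hP.ae_succ hr t (p := fun s a s' => s'.2.2 = nextFlag s.2.2 a) hset
      fun _ _ _ => rfl] with ω h1 h2
    rw [h2, π.mem_aliveSet_succ, ← h1, nextFlag]
    split_ifs with h <;> simp [h]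

/-- The pair (filter, observation) is Markov with the transition law `S`. -/
theorem lintegral_trajState_succ (hP : IsPolicyLaw R lam r x y π P)
    (hr : Measurable fun p : (𝕏 × 𝕐) × (𝕏 × 𝕐) => r p.1 p.2) (t : Fin N)
    {F : (Fin (N + 1) → MState 𝕏 𝕐) × (ProbabilityMeasure 𝕏 × 𝕐) → ℝ≥0∞} (hF : Measurable F) :
    ∫⁻ ω, F (trunc t.castSucc ω, trajState t.succ ω) ∂P
      = ∫⁻ ω, ∫⁻ q, F (trunc t.castSucc ω, q) ∂filterK R lam hr (trajState t.castSucc ω) ∂P := by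
  have hc := (π.isPolicyLaw_iff hr).1 hP
  have := hc.isProb
  have hm : Measurable fun z : (Fin (N + 1) → MState 𝕏 𝕐) × MState 𝕏 𝕐 =>
      (z.1, (z.2.1, z.2.2.1)) := by fun_prop
  have h := lintegral_of_map_prodMk_eq_compProd (measurable_pi_apply _) (measurable_trunc _) _
    (hc.joint t) (hF.comp hm)
  refine h.trans (lintegral_congr fun ω => ?_)
  -- Forgetting the flag removes the action from the transition law.
  rw [π.stepKernel_trunc, π.stepKernel_apply, modelK_eq_map]
  exact lintegral_map (hF.comp (hm.comp (measurable_prodMk_left (x := trunc t.castSucc ω))))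
    (measurable_withFlag _)

theorem restrict_map_trajState (hP : IsPolicyLaw R lam r x y π P)
    (hr : Measurable fun p : (𝕏 × 𝕐) × (𝕏 × 𝕐) => r p.1 p.2) (t : Fin N) :
    (P.restrict (π.aliveSet t.succ)).map (trajState t.succ)
      = filterK R lam hr ∘ₘ (P.restrict (π.aliveSet t.succ)).map (trajState t.castSucc) := by
  have h := restrict_map_eq_comp_of_lintegral (P := P) (measurable_trajState t.castSucc)
    (measurable_trajState t.succ) (measurable_trunc t.castSucc)
    (fun F hF => hP.lintegral_trajState_succ hr t hF) (π.measurableSet_aliveSet t.succ)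
  have : trunc t.castSucc ⁻¹' π.aliveSet t.succ
      = (π.aliveSet t.succ : Set (Fin (N + 1) → MState 𝕏 𝕐)) :=
    Set.ext fun ω => π.trunc_mem_aliveSet_succ
  rwa [this] at h

omit [IsMarkovKernel R] in
theorem integral_trajState_zero (hP : IsPolicyLaw R lam r x y π P)
    {f : ProbabilityMeasure 𝕏 × 𝕐 → ℝ} (hf : Measurable f) :
    ∫ ω, f (trajState 0 ω) ∂P = f (⟨Measure.dirac x, inferInstance⟩, y) := by
  have h0 : Measurable fun ω : Fin (N + 1) → MState 𝕏 𝕐 => ω 0 := measurable_pi_apply 0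
  have hm : Measurable fun s : MState 𝕏 𝕐 => f (s.1, s.2.1) := hf.comp (by fun_prop)
  have h := integral_map (μ := P) h0.aemeasurable hm.aestronglyMeasurable
  rw [hP.initial] at h
  exact h.symm.trans (integral_dirac' _ _ hm.stronglyMeasurable)

/-- By `ae_flag`, the stage reward at `t` is paid exactly on the paths that survive to `t` and act
there, and the terminal reward on those that never act. -/
theorem reward_eq_stopPerf (hP : IsPolicyLaw R lam r x y π P)
    (hr : Measurable fun p : (𝕏 × 𝕐) × (𝕏 × 𝕐) => r p.1 p.2) (hH : Measurable H)
    (hC : ∀ p, |H p| ≤ C) :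
    π.reward H P = stopPerf P (avgReward H) π.aliveSet trajState := by
  have := hP.isProb
  have hint : ∀ t, Integrable (fun ω => avgReward H (trajState t ω)) P := fun t =>
    integrable_comp_of_bounded (measurable_avgReward hH) (abs_avgReward_le hC)
      (measurable_trajState t)
  have hstage : ∀ t : Fin N, (fun ω => stageReward H (ω t.castSucc) (π.action ω t)) =ᵐ[P]
      (π.aliveSet t.castSucc \ π.aliveSet t.succ).indicator
        fun ω => avgReward H (trajState t.castSucc ω) := fun t => by
    filter_upwards [hP.ae_flag hr t.castSucc] with ω hω
    have h1 : (ω t.castSucc).2.2 = 0 ∧ π.action ω t = 1 ↔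
        ω ∈ π.aliveSet t.castSucc \ π.aliveSet t.succ := by
      rw [Set.mem_sdiff, π.mem_aliveSet_succ, hω]
      have : π.action ω t = 1 ↔ ¬ π.action ω t = 0 := by omega
      tauto
    by_cases h : ω ∈ π.aliveSet t.castSucc \ π.aliveSet t.succ
    · rw [Set.indicator_of_mem h]
      exact if_pos (h1.2 h)
    · rw [Set.indicator_of_notMem h]
      exact if_neg fun h' => h (h1.1 h')
  have hterm : (fun ω => terminalReward H (ω (Fin.last N))) =ᵐ[P]
      (π.aliveSet (Fin.last N)).indicator fun ω => avgReward H (trajState (Fin.last N) ω) := by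
    filter_upwards [hP.ae_flag hr (Fin.last N)] with ω hω
    by_cases h : ω ∈ π.aliveSet (Fin.last N)
    · rw [Set.indicator_of_mem h]
      exact if_pos (hω.2 h)
    · rw [Set.indicator_of_notMem h]
      exact if_neg fun h' => h (hω.1 h')
  have hms : ∀ t : Fin N, MeasurableSet
      (π.aliveSet t.castSucc \ π.aliveSet t.succ : Set (Fin (N + 1) → MState 𝕏 𝕐)) := fun t =>
    (π.measurableSet_aliveSet _).diff (π.measurableSet_aliveSet _)
  rw [Policy.reward, integral_finsetSum _ fun t _ =>
    ((hint t.castSucc).indicator (hms t)).congr (hstage t).symm, integral_congr_ae hterm,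
    integral_indicator (π.measurableSet_aliveSet _), stopPerf]
  congr 1
  refine Finset.sum_congr rfl fun t _ => ?_
  rw [integral_congr_ae (hstage t), integral_indicator (hms t)]

/-- No policy does better than the value function. -/
theorem reward_le (hP : IsPolicyLaw R lam r x y π P)
    (hr : Measurable fun p : (𝕏 × 𝕐) × (𝕏 × 𝕐) => r p.1 p.2) (hH : Measurable H)
    (hC : ∀ p, |H p| ≤ C) :
    π.reward H P
      ≤ stopVal (filterK R lam hr) (avgReward H) N (⟨Measure.dirac x, inferInstance⟩, y) := by
  have := hP.isProb
  have hm := measurable_avgReward hH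
  rw [hP.reward_eq_stopPerf hr hH hC, ← hP.integral_trajState_zero (measurable_stopVal hm N)]
  exact stopPerf_le_stopVal hm (abs_avgReward_le hC) measurable_trajState
    π.measurableSet_aliveSet
    (Set.eq_univ_of_forall fun ω s hs => absurd hs (Fin.not_lt_zero _))
    (fun t ω hω => (π.mem_aliveSet_succ.1 hω).1) (hP.restrict_map_trajState hr)

/-- The filter component is almost surely the filter computed from the observations. -/
theorem ae_trajState [MeasurableSpace.CountablyGenerated 𝕏] (hP : IsPolicyLaw R lam r x y π P)
    (hr : Measurable fun p : (𝕏 × 𝕐) × (𝕏 × 𝕐) => r p.1 p.2) (t : Fin (N + 1)) :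
    ∀ᵐ ω ∂P, trajState t ω = filterState lam r x t fun s => (ω s).2.1 := by
  induction t using Fin.induction with
  | zero =>
    have hfst : Measurable fun s : MState 𝕏 𝕐 => s.1 := measurable_fst
    -- Singletons of probability measures are measurable because `𝕏` is countably generated. The
    -- observation components agree by definition.
    filter_upwards [hP.ae_zero (hfst (measurableSet_singleton (α := ProbabilityMeasure 𝕏)
      ⟨Measure.dirac x, inferInstance⟩)) rfl] with ω hω
    exact Prod.ext hω rfl
  | succ t ih =>
    have hset : MeasurableSet {z : (MState 𝕏 𝕐 × Fin 2) × MState 𝕏 𝕐 |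
        z.2.1 = bayes lam r z.2.2.1 z.1.1.1 z.1.1.2.1} :=
      measurableSet_eq_fun (by fun_prop)
        (measurable_bayes_comp hr (by fun_prop) (by fun_prop) (by fun_prop))
    filter_upwards [ih, hP.ae_succ hr t
      (p := fun s _ s' => s'.1 = bayes lam r s'.2.1 s.1 s.2.1) hset fun _ _ _ => rfl] with ω h1 h2
    refine Prod.ext ?_ rfl
    have h3 : (ω t.castSucc).1 = filterPath lam r x t.castSucc fun s => (ω s).2.1 :=
      congrArg Prod.fst h1
    change (ω t.succ).1 = filterPath lam r x t.succ fun s => (ω s).2.1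
    rw [filterPath_succ, h2, h3]

end IsPolicyLaw

open Classical in
/-- The policy that stops as soon as this is optimal for the filter computed from the
observations. -/
def optimalPolicy (R : Kernel (𝕏 × 𝕐) (𝕏 × 𝕐)) [IsMarkovKernel R] (lam : ProbabilityMeasure 𝕏)
    (hr : Measurable fun p : (𝕏 × 𝕐) × (𝕏 × 𝕐) => r p.1 p.2) (hH : Measurable H) (N : ℕ) (x : 𝕏) :
    Policy 𝕐 N where
  -- The observed history is extended by the current observation at times from `t` on; the values
  -- beyond `t` do not matter, since the filter at `t` reads no later coordinate.
  act t w := if StopNow (filterK R lam hr) (avgReward H) N t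
      (filterState lam r x t.castSucc fun s : Fin (N + 1) =>
        if hs : s.val < t.val then (w.1 ⟨s, hs⟩).1 else w.2.1) then 1 else 0
  measurable_act t := by
    have hpath : Measurable fun (w : (Fin t → 𝕐 × Fin 2 × Fin 2) × (𝕐 × Fin 2))
        (s : Fin (N + 1)) => if hs : s.val < t.val then (w.1 ⟨s, hs⟩).1 else w.2.1 := by
      refine measurable_pi_iff.2 fun s => ?_
      by_cases hs : s.val < t.val
      · simp only [dif_pos hs]
        exact measurable_fst.comp ((measurable_pi_apply _).comp measurable_fst)
      · simp only [dif_neg hs]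
        exact measurable_fst.comp measurable_snd
    exact Measurable.ite (((measurable_filterState hr x t.castSucc).comp hpath)
      (measurableSet_stopNow (measurable_avgReward hH) N t)) measurable_const measurable_const

open Classical in
theorem action_optimalPolicy (hr : Measurable fun p : (𝕏 × 𝕐) × (𝕏 × 𝕐) => r p.1 p.2)
    (hH : Measurable H) (t : Fin N) (ω : Fin (N + 1) → MState 𝕏 𝕐) :
    (optimalPolicy R lam hr hH N x).action ω t
      = if StopNow (filterK R lam hr) (avgReward H) N t
        (filterState lam r x t.castSucc fun s => (ω s).2.1) then 1 else 0 := by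
  rw [Policy.action_eq]
  simp only [optimalPolicy]
  congr 2
  refine filterState_congr x fun s hs => ?_
  split_ifs with hlt
  · rfl
  · have : s = t.castSucc := le_antisymm hs (not_lt.1 hlt)
    rw [this]

/-- The policy applies the criterion to the filter computed from the observations, dynamic
programming to the filter coordinate; `ae_trajState` makes the two agree almost surely. -/
theorem IsPolicyLaw.reward_optimalPolicy [MeasurableSpace.CountablyGenerated 𝕏]
    (hr : Measurable fun p : (𝕏 × 𝕐) × (𝕏 × 𝕐) => r p.1 p.2) (hH : Measurable H)
    (hC : ∀ p, |H p| ≤ C) {P : Measure (Fin (N + 1) → MState 𝕏 𝕐)}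
    (hP : IsPolicyLaw R lam r x y (optimalPolicy R lam hr hH N x) P) :
    (optimalPolicy R lam hr hH N x).reward H P
      = stopVal (filterK R lam hr) (avgReward H) N (⟨Measure.dirac x, inferInstance⟩, y) := by
  classical
  have := hP.isProb
  have hm := measurable_avgReward hH
  set π := optimalPolicy R lam hr hH N x with hπ
  rw [hP.reward_eq_stopPerf hr hH hC, ← hP.integral_trajState_zero (measurable_stopVal hm N)]
  refine stopPerf_eq_stopVal hm (abs_avgReward_le hC) measurable_trajState
    π.measurableSet_aliveSet
    (Set.eq_univ_of_forall fun ω s hs => absurd hs (Fin.not_lt_zero _))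
    (fun t ω hω => (π.mem_aliveSet_succ.1 hω).1) (hP.restrict_map_trajState hr) ?_ ?_
  · intro t
    filter_upwards [hP.ae_trajState hr t.castSucc] with ω h1 hω
    have h2 := (π.mem_aliveSet_succ.1 hω).2
    rw [hπ, action_optimalPolicy, ← h1] at h2
    by_contra hlt
    exact one_ne_zero ((if_pos (not_le.1 hlt).le).symm.trans h2)
  · intro t
    filter_upwards [hP.ae_trajState hr t.castSucc] with ω h1 hω
    have h2 : π.action ω t ≠ 0 := fun h => hω.2 (π.mem_aliveSet_succ.2 ⟨hω.1, h⟩)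
    rw [hπ, action_optimalPolicy, ← h1] at h2
    by_contra hlt
    exact h2 (if_neg hlt)

end Model

/-! ### Consequences of the density hypotheses, and the conclusion. -/

theorem eq_withDensity_of_rectangles {𝕏 𝕐 : Type*} [MeasurableSpace 𝕏] [MeasurableSpace 𝕐]
    {R : Kernel (𝕏 × 𝕐) (𝕏 × 𝕐)} [IsMarkovKernel R] {lam : ProbabilityMeasure 𝕏}
    {nu : ProbabilityMeasure 𝕐} {r : 𝕏 × 𝕐 → 𝕏 × 𝕐 → ℝ≥0}
    (h : ∀ (p : 𝕏 × 𝕐) (B : Set 𝕏) (C : Set 𝕐), MeasurableSet B → MeasurableSet C →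
      R p (B ×ˢ C) = ∫⁻ q in B ×ˢ C, r q p ∂((lam : Measure 𝕏).prod (nu : Measure 𝕐)))
    (p : 𝕏 × 𝕐) :
    R p = ((lam : Measure 𝕏).prod (nu : Measure 𝕐)).withDensity fun q => r q p :=
  Measure.ext_prod fun {B C} hB hC => by
    rw [h p B C hB hC, withDensity_apply _ (hB.prod hC)]

theorem obsDensity_ne_top {𝕏 𝕐 : Type*} [MeasurableSpace 𝕏] {lam : ProbabilityMeasure 𝕏}
    {r : 𝕏 × 𝕐 → 𝕏 × 𝕐 → ℝ≥0} {c : ℝ} (h : ∀ q p, (r q p : ℝ) ≤ c) (v : 𝕐)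
    (θ : ProbabilityMeasure 𝕏) (y : 𝕐) : obsDensity lam r v θ y ≠ ∞ := by
  have hle : ∀ q p, (r q p : ℝ≥0∞) ≤ c.toNNReal := fun q p =>
    ENNReal.coe_le_coe.2 (NNReal.le_toNNReal_of_coe_le (h q p))
  refine ne_top_of_le_ne_top (ENNReal.coe_ne_top (r := c.toNNReal)) ?_
  calc obsDensity lam r v θ y
      ≤ ∫⁻ _, ∫⁻ _, (c.toNNReal : ℝ≥0∞) ∂(θ : Measure 𝕏) ∂(lam : Measure 𝕏) :=
        lintegral_mono fun u => lintegral_mono fun x => hle _ _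
    _ = c.toNNReal := by simp

end

end POStopping

theorem theorem2p2 {m n : ℕ}
    (𝕏 : Set (EuclideanSpace ℝ (Fin m))) (h𝕏 : MeasurableSet 𝕏)
    (𝕐 : Set (EuclideanSpace ℝ (Fin n))) (h𝕐 : MeasurableSet 𝕐)
    (N₀ : ℕ) (R : Kernel (𝕏 × 𝕐) (𝕏 × 𝕐)) [IsMarkovKernel R] (H : 𝕏 × 𝕐 → ℝ)
    (lam : ProbabilityMeasure 𝕏) (nu : ProbabilityMeasure 𝕐)
    (r : 𝕏 × 𝕐 → 𝕏 × 𝕐 → ℝ≥0)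
    (hr : Measurable fun p : (𝕏 × 𝕐) × (𝕏 × 𝕐) => r p.1 p.2)
    (hA1 : ∀ (p : 𝕏 × 𝕐) (B : Set 𝕏) (C : Set 𝕐), MeasurableSet B → MeasurableSet C →
      R p (B ×ˢ C) = ∫⁻ q in B ×ˢ C, r q p ∂((lam : Measure 𝕏).prod (nu : Measure 𝕐)))
    (hB1 : ∃ rbar : ℝ, 0 < rbar ∧ ∀ q p : 𝕏 × 𝕐, (r q p : ℝ) ≤ rbar)
    (hB2 : ∃ Lr : ℝ, 0 < Lr ∧ ∀ (u u' : 𝕏) (v : 𝕐) (x x' : 𝕏) (y y' : 𝕐),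
      |(r (u, v) (x, y) : ℝ) - r (u', v) (x', y')| ≤ Lr * (dist u u' + dist x x' + dist y y'))
    (hD : (∃ C : ℝ, ∀ p, |H p| ≤ C) ∧ ∃ K : ℝ≥0, LipschitzWith K H)
    (x : 𝕏) (y : 𝕐) :
    (∀ π : Policy 𝕐 N₀, ∃! P, IsPolicyLaw R lam r x y π P) ∧
    IsLUB (controlRewards.{u} R H N₀ x y) (stoppingValue.{u} R H N₀ x y) ∧
    IsLUB (policyRewards R lam r H N₀ x y) (modelValue R lam r H N₀ x y) ∧
    stoppingValue.{u} R H N₀ x y = modelValue R lam r H N₀ x y ∧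
    modelValue R lam r H N₀ x y =
      (bellman R lam r H)^[N₀] (avgReward H) (⟨Measure.dirac x, inferInstance⟩, y) := by
  obtain ⟨rbar, -, hrbar⟩ := hB1
  obtain ⟨⟨C, hC⟩, K, hK⟩ := hD
  have hH : Measurable H := hK.continuous.measurable
  have hR := eq_withDensity_of_rectangles hA1
  have hfin := obsDensity_ne_top (lam := lam) hrbar
  rw [← stopVal_filterK hr H N₀]
  set V := stopVal (filterK R lam hr) (avgReward H) N₀ (⟨Measure.dirac x, inferInstance⟩, y)
  -- Attainment makes each reward set nonempty with greatest element `V`, so the real-valued `sSup`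
  -- is a genuine supremum and not a default value.
  have hcontrol : IsGreatest (controlRewards.{u} R H N₀ x y) V := by
    refine ⟨exists_weakControl_reward_eq x y hr hR hfin hH hC, ?_⟩
    rintro _ ⟨l, rfl⟩
    exact l.reward_le hr hR hfin hH hC
  have hpolicy : IsGreatest (policyRewards R lam r H N₀ x y) V := by
    constructor
    · obtain ⟨P, hP, -⟩ := (optimalPolicy R lam hr hH N₀ x).existsUnique_law
        (R := R) (lam := lam) (x := x) (y := y) hr
      exact ⟨_, P, hP, (hP.reward_optimalPolicy hr hH hC).symm⟩
    · rintro _ ⟨π, P, hP, rfl⟩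
      exact hP.reward_le hr hH hC
  have hs : stoppingValue.{u} R H N₀ x y = V := hcontrol.csSup_eq
  have hm : modelValue R lam r H N₀ x y = V := hpolicy.csSup_eq
  rw [hs, hm]
  exact ⟨fun π => π.existsUnique_law hr, hcontrol.isLUB, hpolicy.isLUB, rfl, rfl⟩
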